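/- Let $k$ be a field, $R=k[x_1,\dots,x_n]$, and let $\succ$ be the graded reverse lexicographic order; $\mathrm{LM}(f)$ is the leading monomial of $f\neq 0$, and $\langle \mathrm{LM}(G)\rangle$ is the ideal generated by the leading monomials of the nonzero elements of $G$. **Signed matrices.** For a finite sequence $F=(f_1,\dots,f_t)$ of homogeneous polynomials, a *signature* is a monomial $\tau e_i$ of $R^t$; put $\tau e_i\prec\sigma e_j$ iff $i<j$, or $i=j$ and $\tau\prec\sigma$. Rows of matrices are identified with polynomials (their entries are the coefficients) and each row carries a signature. A *valid* row operation adds to a row a $k$-multiple of a row of strictly smaller signature. A row echelon form of $M$ is, up to the order of its rows, a matrix $\widetilde M$ obtained from $M$ by valid operations whose nonzero rows have pairwise distinct leading monomials. The Macaulay matrix $\mathscr M_d(F)$ has the rows $\tau f_i$, with signature $\tau e_i$, for all $i$ and all monomials $\tau$ of degree $d-\deg f_i$. (Here and below, $\deg 0=0$.) A *$(D,\succ)$-Gröbner basis* of $\langle F\rangle$ is the union over $d\le D$ of the sets of rows of echelon forms $\widetilde{\mathscr M}_d(F)$; rows that are redundant may be left out, that is, it is a subset $G$ of such a union $U$ with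 $\langle\mathrm{LM}(G)\rangle=\langle\mathrm{LM}(U)\rangle$. **Algorithm SigGB$(F,S,D)$**, where $S$ is a set of signatures (leading monomials of syzygies of $F$) and $D$ is an integer. Start with $G_1=\dots=G_t=\emptyset$ (all matrices in degrees below $\min_j\deg f_j$ are empty). For $d=\min_j \deg f_j,\dots,D$ let $M_{d,0}=\emptyset$, and for $i=1,\dots,t$: * if $d<\deg f_i$, then $M_{d,i}=M_{d,i-1}$; if $d=\deg f_i$, then $M_{d,i}$ is $\widetilde M_{d,i-1}$ with the row $f_i$ of signature $e_i$ appended; * if $d>\deg f_i$, let $\mathrm{Crit}$ consist of $S$, of all $\mathrm{LM}(f)e_i$ with $f$ a nonzero row of $M_{d-\deg f_i,\,i-1}$, and of all $\tau x_je_i$ ($1\le j\le n$) with $\tau e_i$ the signature of a zero row of $\widetilde M_{d-1,i}$; then $M_{d,i}$ is $\widetilde M_{d,i-1}$ with the following rows appended: for every row $f$ of $M_{d-1,i}$ with signature of the form $\tau e_i$ and every $j\ge\max\{j':x_{j'}\mid\tau\}$ (every $j$ if $\tau=1$) with $\tau x_je_i\notin\mathrm{Crit}$, the row $x_jf$ with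 signature $\tau x_je_i$; * $\widetilde M_{d,i}$ is a row echelon form of $M_{d,i}$, and all rows $f$ of $\widetilde M_{d,i}$ with $f\notin\langle\mathrm{LM}(G_i)\rangle$ are added to $G_i$. Return $G_1,\dots,G_t$; the basis computed for $\langle F\rangle$ is $G_t$. **Algorithm MaxMinorsSigGB$(A,D)$.** Input: a $p\times q$ matrix $A=(a_{i,j})$ over $R$, $p\le q$, with homogeneous entries and homogeneous maximal minors, and an integer $D$. Let $m_1,\dots,m_t$ be the maximal minors of $A$, listed in increasing lexicographic order of their column sequences $j_1<\dots<j_p$. 1. Let $C=(a_{1,1},\dots,a_{p,1},\dots,a_{1,q-p},\dots,a_{p,q-p})$ and let $G_1,\dots,G_{p(q-p)}$ be the output of SigGB$(C,\emptyset,D-\min_j\deg m_j)$. 2. Let $H$ be the set of all $\mathrm{LM}(g)e_j$ such that for some $i\in\{1,\dots,p(q-p)\}$ we have $g\in G_i$ and $m_j$ is a minor of the submatrix of $A$ formed by the columns $\lceil i/p\rceil+1,\dots,q$. 3. Return the basis $G_t$ computed by SigGB$((m_1,\dots,m_t),H,D)$. **Theorem.** MaxMinorsSigGB is correct. That is, each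 matrix whose rows have pairwise distinct signatures has a row echelon form obtained by valid operations, and for every choice of these echelon forms in the two calls of SigGB (as a function of the matrix), the output $G$ of MaxMinorsSigGB$(A,D)$ is a $(D,\succ)$-Gröbner basis of the ideal $I$ of maximal minors of $A$, generated by $m_1,\dots,m_t$. In particular $G\subseteq I$, and for every nonzero homogeneous $f\in I$ of degree at most $D$ there is a nonzero $g\in G$ such that $\mathrm{LM}(g)$ divides $\mathrm{LM}(f)$. -/

import Mathlib

open MvPolynomial

noncomputable section

/-! ### The graded reverse lexicographic order -/

/-- Exponent vectors in `n` variables, to be ordered by grevlex. -/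
def Grevlex (n : ℕ) : Type := Fin n →₀ ℕ

namespace Grevlex

variable {n : ℕ}

instance : AddCommMonoid (Grevlex n) := inferInstanceAs (AddCommMonoid (Fin n →₀ ℕ))

/-- Compare the total degrees first; break ties by reversing the colexicographic order. -/
def key (a : Grevlex n) : ℕ ×ₗ (Colex (Fin n → ℕ))ᵒᵈ :=
  toLex (Finsupp.degree (show Fin n →₀ ℕ from a),
    OrderDual.toDual (toColex (fun i => (show Fin n →₀ ℕ from a) i)))

theorem key_injective : Function.Injective (key (n := n)) := by
  intro a b h
  have h2 := congrArg (fun z => ofColex (OrderDual.ofDual (ofLex z).2)) h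
  exact DFunLike.coe_injective (F := Fin n →₀ ℕ) h2

instance : LinearOrder (Grevlex n) := LinearOrder.lift' key key_injective

/-- The usual description of grevlex: `a ≺ b` if and only if `a` has smaller total degree, or
the degrees agree and at the last variable where the exponents differ, that of `a` is larger. -/
theorem lt_iff (a b : Fin n →₀ ℕ) : (show Grevlex n from a) < (show Grevlex n from b) ↔
    a.degree < b.degree ∨
      (a.degree = b.degree ∧ ∃ i, (∀ j, i < j → a j = b j) ∧ b i < a i) := by
  have h : ((show Grevlex n from a) < (show Grevlex n from b)) ↔
    key (show Grevlex n from a) < key (show Grevlex n from b) := Iff.rfl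
  rw [h, key, key, Prod.Lex.toLex_lt_toLex]
  refine or_congr Iff.rfl (and_congr Iff.rfl ?_)
  rw [OrderDual.toDual_lt_toDual]
  refine exists_congr fun i => and_congr ?_ Iff.rfl
  exact forall₂_congr fun j _ => eq_comm

theorem add_lt_add (a b c : Fin n →₀ ℕ)
    (h : (show Grevlex n from a) < (show Grevlex n from b)) :
    (show Grevlex n from a + c) < (show Grevlex n from b + c) := by
  refine (lt_iff (a + c) (b + c)).2 ?_
  rcases (lt_iff a b).1 h with h | ⟨h, i, h1, h2⟩
  · left
    simpa only [map_add, add_lt_add_iff_right] using h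
  · right
    refine ⟨by simpa only [map_add, add_left_inj] using h, i, fun j hj => ?_, ?_⟩
    · simpa only [Finsupp.add_apply, add_left_inj] using h1 j hj
    · simpa only [Finsupp.add_apply, add_lt_add_iff_right] using h2

instance : IsOrderedAddMonoid (Grevlex n) where
  add_le_add_left a b hab c := by
    rcases hab.lt_or_eq with h | h
    · exact le_of_lt (add_lt_add a b c h)
    · rw [h]

theorem monotone_of_le {a b : Fin n →₀ ℕ} (h : a ≤ b) :
    (show Grevlex n from a) ≤ (show Grevlex n from b) := by
  by_contra hlt
  obtain ⟨c, rfl⟩ := exists_add_of_le h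
  rcases (lt_iff (a + c) a).1 (not_le.1 hlt) with h' | ⟨h', _⟩
  · simp only [map_add] at h'
    omega
  · have hc : c = 0 := by
      rw [← Finsupp.degree_eq_zero_iff]
      simpa only [map_add, add_eq_left] using h'
    subst hc
    exact hlt (le_of_eq (congrArg (fun z : Fin n →₀ ℕ => (show Grevlex n from z))
      (add_zero a).symm))

instance : WellFoundedLT (Grevlex n) := by
  refine ⟨RelEmbedding.wellFounded_iff_isEmpty.2 ⟨fun f => ?_⟩⟩
  obtain ⟨i, j, hij, h⟩ := wellQuasiOrdered_le (α := Fin n →₀ ℕ) (fun k => f k)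
  exact absurd (f.map_rel_iff.2 hij) (not_lt.2 (monotone_of_le h))

end Grevlex

/-- The graded reverse lexicographic order with `x_1 ≻ x_2 ≻ … ≻ x_n`. -/
def grevlex (n : ℕ) : MonomialOrder (Fin n) where
  syn := Grevlex n
  toSyn := { toEquiv := Equiv.refl _, map_add' := fun _ _ => rfl }
  toSyn_monotone _ _ h := Grevlex.monotone_of_le h

theorem grevlex_lt_iff {n : ℕ} (a b : Fin n →₀ ℕ) :
    (grevlex n).toSyn a < (grevlex n).toSyn b ↔ a.degree < b.degree ∨
      (a.degree = b.degree ∧ ∃ i, (∀ j, i < j → a j = b j) ∧ b i < a i) :=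
  Grevlex.lt_iff a b

section Macaulay

variable {n t : ℕ} {k : Type*} [Field k]

/-- The exponent of the leading monomial of `f` for grevlex (only used for `f ≠ 0`). -/
abbrev lm (f : MvPolynomial (Fin n) k) : Fin n →₀ ℕ := (grevlex n).degree f

/-- The ideal generated by the leading monomials of the nonzero elements of `G`. -/
def lmIdeal (G : Set (MvPolynomial (Fin n) k)) : Ideal (MvPolynomial (Fin n) k) :=
  Ideal.span {u | ∃ g ∈ G, g ≠ 0 ∧ u = monomial (lm g) 1}

/-- A signature: `(i, τ)` stands for the monomial `x^τ e_i` of the free module of rank `t`. -/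
abbrev Sig (n t : ℕ) : Type := Fin t × (Fin n →₀ ℕ)

/-- The position over term order on signatures: `x^τ e_i` is smaller than `x^σ e_j` iff `i < j`,
or `i = j` and `x^τ ≺ x^σ`. -/
def sigLT (s s' : Sig n t) : Prop :=
  s.1 < s'.1 ∨ (s.1 = s'.1 ∧ (grevlex n).toSyn s.2 < (grevlex n).toSyn s'.2)

/-- A matrix with signed rows. A row is stored as its signature and the polynomial whose
coefficients are the entries of the row. -/
abbrev SigMatrix (n t : ℕ) (k : Type*) [Field k] : Type _ :=
  List (Sig n t × MvPolynomial (Fin n) k)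

/-- The set of polynomials given by the rows. -/
def SigMatrix.rows (M : SigMatrix n t k) : Set (MvPolynomial (Fin n) k) :=
  {f | ∃ s, (s, f) ∈ M}

/-- A valid elementary row operation: a `k`-multiple of a row is added to a row of larger
signature. -/
def ValidOp (M M' : SigMatrix n t k) : Prop :=
  ∃ (a b : Fin M.length) (c : k), sigLT (M.get b).1 (M.get a).1 ∧
    M' = M.set a ((M.get a).1, (M.get a).2 + C c * (M.get b).2)

/-- `M'` is a row echelon form of `M` computed via valid elementary row operations. As these
operations never permute rows, being in echelon form means (up to the order of the rows) that the
nonzero rows have pairwise distinct leading monomials. -/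
def IsEchelonForm (M M' : SigMatrix n t k) : Prop :=
  Relation.ReflTransGen ValidOp M M' ∧
    M'.Pairwise fun r r' => r.2 ≠ 0 → r'.2 ≠ 0 → lm r.2 ≠ lm r'.2

/-- A procedure for the echelonization steps: to each matrix whose rows have pairwise distinct
signatures it assigns a row echelon form computed via valid elementary row operations. -/
def IsEchelonProcedure (ech : SigMatrix n t k → SigMatrix n t k) : Prop :=
  ∀ M, (M.map Prod.fst).Nodup → IsEchelonForm M (ech M)

/-- The Macaulay matrix of `F` in degree `d`: one row `x^τ f_i`, with signature `x^τ e_i`, for all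
`i` and all `τ` with `|τ| = d - deg f_i`. -/
def macaulay (F : Fin t → MvPolynomial (Fin n) k) (d : ℕ) : SigMatrix n t k :=
  (List.finRange t).flatMap fun i =>
    if d < (F i).totalDegree then []
    else (Finset.univ.finsuppAntidiag (d - (F i).totalDegree)).toList.map
      fun τ => ((i, τ), monomial τ 1 * F i)

/-- `G` is a `(D, ≻)`-Gröbner basis of the ideal generated by `F`, given by row echelon forms
`E d` of the Macaulay matrices of degrees `d ≤ D`: it consists of rows of the `E d`, and only rows
whose leading monomials are redundant are left out. -/
def IsTruncatedGB (F : Fin t → MvPolynomial (Fin n) k) (D : ℤ)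
    (G : Set (MvPolynomial (Fin n) k)) : Prop :=
  ∃ E : ℕ → SigMatrix n t k, (∀ d, IsEchelonForm (macaulay F d) (E d)) ∧
    G ⊆ {f | ∃ d : ℕ, (d : ℤ) ≤ D ∧ f ∈ (E d).rows} ∧
    lmIdeal G = lmIdeal {f | ∃ d : ℕ, (d : ℤ) ≤ D ∧ f ∈ (E d).rows}

end Macaulay

/-! ### The signature algorithm (matrix-`F_5`) -/

section SigGB

open Classical in
/-- The rows with signature index `i` that are added in degree `d > deg f_i`: for each row `f` of
`Mprev` (degree `d - 1`) with signature `x^τ e_i` and each variable `x_j` that is not before a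
variable dividing `x^τ`, the row `x_j f` with signature `x_j x^τ e_i`, unless it is in `crit`. -/
def newRows {n t : ℕ} {k : Type*} [Field k] (crit : Set (Sig n t)) (i : Fin t)
    (Mprev : SigMatrix n t k) : SigMatrix n t k :=
  (Mprev.filter fun r => r.1.1 = i).flatMap fun r =>
    ((List.finRange n).filter fun j =>
        (∀ j' ∈ r.1.2.support, j' ≤ j) ∧ (i, r.1.2 + Finsupp.single j 1) ∉ crit).map
      fun j => ((i, r.1.2 + Finsupp.single j 1), X j * r.2)

/-- The criterion used for signature index `i` in degree `d > deg f_i`: the given signatures `S`;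
the `F_5` criterion, from the leading monomials of the rows of `K` (the matrix of
`f_1, …, f_{i-1}` in degree `d - deg f_i`); the multiples of the signatures of the rows that were
reduced to zero, in the echelon form `R` in degree `d - 1`. -/
def critSet {n t : ℕ} {k : Type*} [Field k] (S : Set (Sig n t)) (i : Fin t)
    (K R : SigMatrix n t k) : Set (Sig n t) :=
  S ∪ {s | ∃ f ∈ K.rows, f ≠ 0 ∧ s = (i, lm f)} ∪
    {s | ∃ τ j, ((i, τ), (0 : MvPolynomial (Fin n) k)) ∈ R ∧ s = (i, τ + Finsupp.single j 1)}

/-- The matrix `M_{d,i}` of the algorithm, where `i` is the number of generators used so far;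
`ech (sigMatrix ech F S d i)` is its echelon form. It is empty in degrees `d` below all
`deg f_j`. -/
def sigMatrix {n t : ℕ} {k : Type*} [Field k] (ech : SigMatrix n t k → SigMatrix n t k)
    (F : Fin t → MvPolynomial (Fin n) k) (S : Set (Sig n t)) (d : ℕ) : ℕ → SigMatrix n t k
  | 0 => []
  | i + 1 =>
    if hi : i < t then
      if d < (F ⟨i, hi⟩).totalDegree then
        sigMatrix ech F S d i
      else if d = (F ⟨i, hi⟩).totalDegree then
        ech (sigMatrix ech F S d i) ++ [((⟨i, hi⟩, 0), F ⟨i, hi⟩)]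
      else
        ech (sigMatrix ech F S d i) ++
          newRows
            (critSet S ⟨i, hi⟩ (sigMatrix ech F S (d - (F ⟨i, hi⟩).totalDegree) i)
              (ech (sigMatrix ech F S (d - 1) (i + 1))))
            ⟨i, hi⟩ (sigMatrix ech F S (d - 1) (i + 1))
    else []
  termination_by i => (d, i)
  decreasing_by
    all_goals
      refine Prod.lex_def.2 ?_
      dsimp only
      omega

open Classical in
/-- The list `G_i` of the algorithm after the degrees below the last argument have been treated: in each
degree `d` the rows `f` of the echelon form of `M_{d,i}` with `f ∉ ⟨LM(G_i)⟩` are added. -/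
def sigBasis {n t : ℕ} {k : Type*} [Field k] (ech : SigMatrix n t k → SigMatrix n t k)
    (F : Fin t → MvPolynomial (Fin n) k) (S : Set (Sig n t)) (i : ℕ) :
    ℕ → List (MvPolynomial (Fin n) k)
  | 0 => []
  | d + 1 => sigBasis ech F S i d ++
      ((ech (sigMatrix ech F S d i)).map Prod.snd).filter
        fun f => f ∉ lmIdeal {g | g ∈ sigBasis ech F S i d}

/-- The signature algorithm with input `F = (f_1, …, f_t)`, a set `S` of leading monomials of
syzygies of `F` and the degree bound `D`. Its output is `G_1, …, G_t`, where `G_i` is the value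
at `i`. -/
def sigGB {n t : ℕ} {k : Type*} [Field k] (ech : SigMatrix n t k → SigMatrix n t k)
    (F : Fin t → MvPolynomial (Fin n) k) (S : Set (Sig n t)) (D : ℤ) (i : ℕ) :
    List (MvPolynomial (Fin n) k) :=
  sigBasis ech F S i (D + 1).toNat

end SigGB

/-! ### Maximal minors -/

section MaxMinors

open Classical in
/-- The strictly increasing sequences `1 ≤ j_1 < ⋯ < j_p ≤ q`. -/
def incSeqs (p q : ℕ) : Finset (Lex (Fin p → Fin q)) :=
  Finset.univ.filter fun J => StrictMono (ofLex J)

/-- The `j`-th increasing sequence, in increasing lexicographic order. -/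
def minorCols (p q : ℕ) (j : Fin (incSeqs p q).card) : Fin p → Fin q :=
  ofLex ((incSeqs p q).orderEmbOfFin rfl j)

variable {n p q : ℕ} {k : Type*} [Field k]

/-- The sequence of the maximal minors of `A`. -/
def maxMinors (A : Matrix (Fin p) (Fin q) (MvPolynomial (Fin n) k))
    (j : Fin (incSeqs p q).card) : MvPolynomial (Fin n) k :=
  (A.submatrix id (minorCols p q j)).det

/-- The ideal generated by the maximal minors of `A`. -/
def maxMinorsIdeal (A : Matrix (Fin p) (Fin q) (MvPolynomial (Fin n) k)) :
    Ideal (MvPolynomial (Fin n) k) :=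
  Ideal.span {f | ∃ J : Fin p → Fin q, StrictMono J ∧ f = (A.submatrix id J).det}

/-- The entries of the first `q - p` columns of `A`, column by column:
`a_{1,1}, …, a_{p,1}, …, a_{1,q-p}, …, a_{p,q-p}`. -/
def colEntries (A : Matrix (Fin p) (Fin q) (MvPolynomial (Fin n) k))
    (i : Fin ((q - p) * p)) : MvPolynomial (Fin n) k :=
  A i.modNat (Fin.castLE (Nat.sub_le q p) i.divNat)

/-- The leading monomials of syzygies given to the final call: all `LM(g) e_j` where `g` is in the
`i`-th basis `G i` of the column entries and the `j`-th maximal minor only uses columns strictly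
to the right of the column of the `i`-th entry. Here `i` counts from `0`, so `G_{i+1}` is the basis
of the ideal of the entries with indices `0, …, i`, and `i / p` is the column of the last one. -/
def minorSyzygies (p q : ℕ) (G : ℕ → List (MvPolynomial (Fin n) k)) :
    Set (Sig n (incSeqs p q).card) :=
  {s | ∃ i : Fin ((q - p) * p), (∀ r : Fin p, (i.divNat : ℕ) < (minorCols p q s.1 r : ℕ)) ∧
    ∃ g ∈ G (i + 1), s.2 = lm g}

/-- The algorithm for maximal minors. The two echelonization procedures are those used in the
first call (on the column entries) and in the final call (on the maximal minors) of the signature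
algorithm. -/
def maxMinorsSigGB
    (ech₁ : SigMatrix n ((q - p) * p) k → SigMatrix n ((q - p) * p) k)
    (ech₂ : SigMatrix n (incSeqs p q).card k → SigMatrix n (incSeqs p q).card k)
    (A : Matrix (Fin p) (Fin q) (MvPolynomial (Fin n) k)) (D : ℤ) :
    List (MvPolynomial (Fin n) k) :=
  sigGB ech₂ (maxMinors A)
    (minorSyzygies p q
      (sigGB ech₁ (colEntries A) ∅ (D - (sInf {d | ∃ j, d = (maxMinors A j).totalDegree} : ℕ))))
    D (incSeqs p q).card

end MaxMinors

end

/-! Row reduction that respects signatures is a statement about cosets. A valid operation never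
changes the class of a row modulo the span of the rows of smaller signature; conversely, if
signatures are distinct, any replacement of rows within their classes is reached by valid operations
(`reflTransGen_map`). An echelon form of the Macaulay matrix is thus a choice, for each signature
x^τ e_i, of an element of x^τ f_i + (span of the smaller products of the same degree), with distinct
leading monomials among the nonzero choices. Zero may be chosen exactly when x^τ e_i is the leading
monomial of a syzygy (`IsSyzSig`).

So omitting rows is harmless as long as only such signatures are omitted. This is the core of the
invariant `SigInv`, which `sigMatrix_inv` establishes for all matrices of the algorithm: syzygy
signatures are stable under multiplication by variables, and the criteria name only syzygy
signatures if `S` does. Filling in zero rows turns a computed echelon form into one of the Macaulay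
matrix (`SigInv.exists_isEchelonForm_macaulay`).

For maximal minors it remains to see that the signatures in H come from syzygies. Repeating row r of
A and adjoining a column c to the left of J gives a vanishing determinant of size p + 1; its
expansion along the repeated row expresses a_{r,c} m_J through minors that use column c and are
lexicographically smaller (`mul_det_mem_span_lt`). Hence the ideal of the entries of such columns
multiplies m_J into the ideal of the earlier minors, and the leading monomial of each nonzero
homogeneous g in it gives a syzygy signature at m_J. -/

/-! ### Signatures and valid row operations -/

section SignedRows

variable {n t : ℕ} {k : Type*} [Field k]

/-- Signatures, mapped to the lexicographic product that induces `sigLT`. -/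
noncomputable def sigKey (s : Sig n t) : Fin t ×ₗ (grevlex n).syn := toLex (s.1, (grevlex n).toSyn s.2)

theorem sigLT_iff_sigKey_lt {s s' : Sig n t} : sigLT s s' ↔ sigKey s < sigKey s' :=
  (Prod.Lex.toLex_lt_toLex (x := (s.1, (grevlex n).toSyn s.2))
    (y := (s'.1, (grevlex n).toSyn s'.2))).symm

theorem sigKey_injective : Function.Injective (sigKey (n := n) (t := t)) := by
  intro s s' h
  have h1 := congrArg ofLex h
  simp only [sigKey, ofLex_toLex, Prod.mk.injEq, EmbeddingLike.apply_eq_iff_eq] at h1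
  exact Prod.ext h1.1 h1.2

theorem sigLT_irrefl (s : Sig n t) : ¬ sigLT s s := by
  rw [sigLT_iff_sigKey_lt]; exact lt_irrefl _

theorem sigLT_trans {s s' s'' : Sig n t} (h : sigLT s s') (h' : sigLT s' s'') : sigLT s s'' := by
  rw [sigLT_iff_sigKey_lt] at *; exact h.trans h'

theorem sigLT_trichotomy (s s' : Sig n t) : sigLT s s' ∨ s = s' ∨ sigLT s' s := by
  simp only [sigLT_iff_sigKey_lt, ← sigKey_injective.eq_iff]
  exact lt_trichotomy _ _

/-- The signatures smaller than `s`. -/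
def sigBelow (s : Sig n t) : Set (Sig n t) := {s' | sigLT s' s}

/-- Closure under passing to smaller signatures. -/
def IsSigLower (A : Set (Sig n t)) : Prop := ∀ s ∈ A, sigBelow s ⊆ A

theorem isSigLower_sigBelow (s : Sig n t) : IsSigLower (sigBelow s) :=
  fun _ h _ h' => sigLT_trans h' h

/-- The span of the rows of `M` whose signatures lie in `A`. -/
noncomputable def rowSpan (M : SigMatrix n t k) (A : Set (Sig n t)) : Submodule k (MvPolynomial (Fin n) k) :=
  Submodule.span k {f | ∃ s ∈ A, (s, f) ∈ M}

theorem mem_rowSpan {M : SigMatrix n t k} {A : Set (Sig n t)} {s : Sig n t}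
    {f : MvPolynomial (Fin n) k} (hs : s ∈ A) (hf : (s, f) ∈ M) : f ∈ rowSpan M A :=
  Submodule.subset_span ⟨s, hs, hf⟩

theorem rowSpan_mono {M : SigMatrix n t k} {A B : Set (Sig n t)} (h : A ⊆ B) :
    rowSpan M A ≤ rowSpan M B :=
  Submodule.span_mono fun _ ⟨s, hs, hf⟩ => ⟨s, h hs, hf⟩

theorem rowSpan_le {M : SigMatrix n t k} {A : Set (Sig n t)}
    {V : Submodule k (MvPolynomial (Fin n) k)} :
    rowSpan M A ≤ V ↔ ∀ s ∈ A, ∀ f, (s, f) ∈ M → f ∈ V := by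
  rw [rowSpan, Submodule.span_le]
  exact ⟨fun h s hs f hf => h ⟨s, hs, hf⟩, fun h f ⟨s, hs, hf⟩ => h s hs f hf⟩

/-- The relation between two signed matrices that valid row operations preserve. -/
structure SigEquiv (M M' : SigMatrix n t k) : Prop where
  sigs_eq : M'.map Prod.fst = M.map Prod.fst
  sub_mem : ∀ s f', (s, f') ∈ M' → ∃ f, (s, f) ∈ M ∧ f' - f ∈ rowSpan M (sigBelow s)
  rowSpan_eq : ∀ A, IsSigLower A → rowSpan M' A = rowSpan M A

theorem SigEquiv.refl (M : SigMatrix n t k) : SigEquiv M M :=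
  ⟨rfl, fun _ f hf => ⟨f, hf, by simp⟩, fun _ _ => rfl⟩

theorem SigEquiv.trans {M M' M'' : SigMatrix n t k} (h : SigEquiv M M') (h' : SigEquiv M' M'') :
    SigEquiv M M'' := by
  refine ⟨h'.sigs_eq.trans h.sigs_eq, fun s f'' hf'' => ?_,
    fun A hA => (h'.rowSpan_eq A hA).trans (h.rowSpan_eq A hA)⟩
  obtain ⟨f', hf', hd'⟩ := h'.sub_mem s f'' hf''
  obtain ⟨f, hf, hd⟩ := h.sub_mem s f' hf'
  rw [h.rowSpan_eq _ (isSigLower_sigBelow s)] at hd'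
  exact ⟨f, hf, by simpa using add_mem hd' hd⟩

/-- The added row has smaller signature, so it lies in every lower set that contains the changed
one. It is itself unchanged, so subtracting it again recovers the old row. -/
theorem ValidOp.sigEquiv {M M' : SigMatrix n t k} (h : ValidOp M M') : SigEquiv M M' := by
  obtain ⟨a, b, c, hba, rfl⟩ := h
  have hab : (a : ℕ) ≠ b := by
    intro h
    rw [Fin.ext h] at hba
    exact sigLT_irrefl _ hba
  have ha : ((M.get a).1, (M.get a).2) ∈ M := List.get_mem M a
  have hb : ((M.get b).1, (M.get b).2) ∈ M := List.get_mem M b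
  generalize hM' : M.set a ((M.get a).1, (M.get a).2 + C c * (M.get b).2) = M'
  have hnew : ((M.get a).1, (M.get a).2 + C c * (M.get b).2) ∈ M' := by
    rw [← hM']; exact List.mem_set a.2 _
  have hb' : ((M.get b).1, (M.get b).2) ∈ M' := by
    rw [← hM', List.mem_iff_getElem]
    exact ⟨b, by simp, by simp [hab]⟩
  have hold : ∀ r ∈ M, r ∈ M' ∨ r = M.get a := by
    intro r hr
    obtain ⟨i, hi, rfl⟩ := List.mem_iff_getElem.1 hr
    by_cases hia : (a : ℕ) = i
    · right; subst hia; simp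
    · left
      rw [← hM', List.mem_iff_getElem]
      exact ⟨i, by simpa using hi, by simp [hia]⟩
  have hmem : ∀ r ∈ M', r ∈ M ∨ r = ((M.get a).1, (M.get a).2 + C c * (M.get b).2) := by
    intro r hr
    rw [← hM'] at hr
    exact List.mem_or_eq_of_mem_set hr
  refine ⟨?_, fun s f' hf' => ?_, fun A hA => le_antisymm ?_ ?_⟩
  · rw [← hM', List.map_set]
    apply List.ext_getElem
    · simp
    · intro i h1 h2
      by_cases hia : (a : ℕ) = i
      · subst hia; simp
      · simp [hia]
  · rcases hmem _ hf' with h | h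
    · exact ⟨f', h, by simp⟩
    · rw [Prod.mk.injEq] at h
      obtain ⟨rfl, rfl⟩ := h
      refine ⟨_, ha, ?_⟩
      rw [add_sub_cancel_left, C_mul']
      exact Submodule.smul_mem _ _ (mem_rowSpan hba hb)
  · rw [rowSpan_le]
    intro s hs f hf
    rcases hmem _ hf with h | h
    · exact mem_rowSpan hs h
    · rw [Prod.mk.injEq] at h
      obtain ⟨rfl, rfl⟩ := h
      rw [C_mul']
      exact add_mem (mem_rowSpan hs ha) (Submodule.smul_mem _ _ (mem_rowSpan (hA _ hs hba) hb))
  · rw [rowSpan_le]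
    intro s hs f hf
    rcases hold _ hf with h | h
    · exact mem_rowSpan hs h
    · have hs' : s = (M.get a).1 := congrArg Prod.fst h
      have hf' : f = (M.get a).2 := congrArg Prod.snd h
      subst hs' hf'
      have h1 := mem_rowSpan hs hnew
      have h2 := Submodule.smul_mem _ c (mem_rowSpan (hA _ hs hba) hb')
      rw [C_mul'] at h1
      simpa using sub_mem h1 h2

theorem sigEquiv_of_reflTransGen {M M' : SigMatrix n t k}
    (h : Relation.ReflTransGen ValidOp M M') : SigEquiv M M' := by
  induction h with
  | refl => exact SigEquiv.refl M
  | tail _ h ih => exact ih.trans h.sigEquiv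

/-- Only row `a` changes, so the rows of smaller signature stay available and a combination of them
can be added term by term. -/
theorem reflTransGen_set {M : SigMatrix n t k} {a : ℕ} (ha : a < M.length)
    {v : MvPolynomial (Fin n) k} (hv : v ∈ rowSpan M (sigBelow M[a].1)) :
    Relation.ReflTransGen ValidOp M (M.set a (M[a].1, M[a].2 + v)) := by
  -- The current content `w` and the scalar `c` are left free so that sums and scalar multiples pass
  -- through the span induction.
  suffices H : ∀ (c : k) w, Relation.ReflTransGen ValidOp (M.set a (M[a].1, w))
      (M.set a (M[a].1, w + c • v)) by
    simpa using H 1 M[a].2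
  induction hv using Submodule.span_induction with
  | mem v hv =>
    intro c w
    obtain ⟨s, hs, hv⟩ := hv
    obtain ⟨b, hb, hbv⟩ := List.mem_iff_getElem.1 hv
    have hab : a ≠ b := by
      rintro rfl
      rw [hbv] at hs
      exact sigLT_irrefl _ hs
    refine Relation.ReflTransGen.single ⟨⟨a, by simpa using ha⟩, ⟨b, by simpa using hb⟩, c, ?_, ?_⟩
    · simpa [hab, hbv, sigBelow] using hs
    · simp [hab, hbv, C_mul']
  | zero => intro c w; simpa using Relation.ReflTransGen.refl
  | add x y _ _ hx hy =>
    intro c w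
    rw [smul_add, ← add_assoc]
    exact (hx c w).trans (hy c _)
  | smul r x _ hx =>
    intro c w
    rw [smul_smul]
    exact hx _ w

/-- If the row of signature `s` is to become `T s`, and each `T s` differs from the old row by a
combination of rows of smaller signatures, then valid operations achieve it, starting from the
largest signature. -/
theorem reflTransGen_map {M : SigMatrix n t k} (hM : (M.map Prod.fst).Nodup)
    (T : Sig n t → MvPolynomial (Fin n) k)
    (hT : ∀ s f, (s, f) ∈ M → T s - f ∈ rowSpan M (sigBelow s)) :
    Relation.ReflTransGen ValidOp M (M.map fun r => (r.1, T r.1)) := by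
  have H : ∀ A : Finset (Sig n t), Relation.ReflTransGen ValidOp M
      (M.map fun r => (r.1, if r.1 ∈ A then T r.1 else r.2)) := by
    intro A
    induction A using Finset.induction_on_min_value (f := sigKey) with
    | empty => simpa using Relation.ReflTransGen.refl
    | insert s A hs hmin ih =>
      refine ih.trans ?_
      set N := M.map fun r => (r.1, if r.1 ∈ A then T r.1 else r.2) with hN
      by_cases hsM : s ∈ M.map Prod.fst
      · obtain ⟨⟨s', f⟩, hf, rfl⟩ := List.mem_map.1 hsM
        obtain ⟨a, ha, haf⟩ := List.mem_iff_getElem.1 hf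
        have haN : a < N.length := by simpa [hN] using ha
        have hNa : N[a] = (s', f) := by simp [hN, haf, hs]
        -- All signatures treated so far are at least `s'`, so the rows below it are still the
        -- original ones.
        have hle : rowSpan M (sigBelow s') ≤ rowSpan N (sigBelow s') := by
          rw [rowSpan_le]
          intro s'' hs'' g hg
          refine mem_rowSpan hs'' (List.mem_map.2 ⟨_, hg, ?_⟩)
          have : s'' ∉ A := fun h => absurd (hmin _ h) (not_le.2 (sigLT_iff_sigKey_lt.1 hs''))
          simp [this]
        have key := reflTransGen_set haN (v := T s' - f) (by rw [hNa]; exact hle (hT _ _ hf))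
        convert key using 1
        apply List.ext_getElem
        · simp [hN]
        · intro i h1 h2
          have hi : i < M.length := by simpa using h1
          rw [List.getElem_set, List.getElem_map]
          by_cases hai : a = i
          · subst hai
            simp [hNa, haf]
          · have hne : M[i].1 ≠ s' := by
              intro h
              refine hai ((List.nodup_iff_injective_get.1 hM).eq_iff (a := ⟨a, by simpa using ha⟩)
                (b := ⟨i, by simpa using hi⟩) |>.1 ?_ |> fun h => congrArg Fin.val h)
              simp [haf, h]
            simp [hai, hN, hne]
      · have : (M.map fun r => (r.1, if r.1 ∈ insert s A then T r.1 else r.2)) = N := by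
          refine List.map_congr_left fun r hr => ?_
          have : r.1 ≠ s := fun h => hsM (List.mem_map.2 ⟨r, hr, h⟩)
          simp [this]
        rw [this]
  have h := H (M.map Prod.fst).toFinset
  have h2 : (M.map fun r => (r.1, if r.1 ∈ (M.map Prod.fst).toFinset then T r.1 else r.2)) =
      M.map fun r => (r.1, T r.1) := by
    refine List.map_congr_left fun r hr => ?_
    have : r.1 ∈ (M.map Prod.fst).toFinset := List.mem_toFinset.2 (List.mem_map.2 ⟨r, hr, rfl⟩)
    rw [if_pos this]
  rwa [h2] at h

theorem isEchelonForm_map {M : SigMatrix n t k} (hM : (M.map Prod.fst).Nodup)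
    (T : Sig n t → MvPolynomial (Fin n) k)
    (hT : ∀ s f, (s, f) ∈ M → T s - f ∈ rowSpan M (sigBelow s))
    (hlm : ∀ r ∈ M, ∀ r' ∈ M, r.1 ≠ r'.1 → T r.1 ≠ 0 → T r'.1 ≠ 0 → lm (T r.1) ≠ lm (T r'.1)) :
    IsEchelonForm M (M.map fun r => (r.1, T r.1)) := by
  refine ⟨reflTransGen_map hM T hT, ?_⟩
  rw [List.pairwise_map]
  exact (List.pairwise_map.1 hM).imp_of_mem fun h h' hne => hlm _ h _ h' hne

theorem eq_of_mem_of_nodup {M : SigMatrix n t k} (hM : (M.map Prod.fst).Nodup) {s : Sig n t}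
    {f g : MvPolynomial (Fin n) k} (hf : (s, f) ∈ M) (hg : (s, g) ∈ M) : f = g :=
  congrArg Prod.snd (List.inj_on_of_nodup_map hM hf hg rfl)

/-! ### Existence of echelon forms -/

/-- Elimination of a leading monomial. -/
theorem exists_sub_smul_lt {f g : MvPolynomial (Fin n) k} (hg : g ≠ 0)
    (h : lm f = lm g) : ∃ c : k, f - c • g = 0 ∨
      (grevlex n).toSyn (lm (f - c • g)) < (grevlex n).toSyn (lm f) := by
  have hlc : (grevlex n).leadingCoeff g ≠ 0 := MonomialOrder.leadingCoeff_ne_zero_iff.2 hg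
  refine ⟨(grevlex n).leadingCoeff f / (grevlex n).leadingCoeff g, ?_⟩
  set c := (grevlex n).leadingCoeff f / (grevlex n).leadingCoeff g with hc
  by_cases h0 : f - c • g = 0
  · exact Or.inl h0
  refine Or.inr (lt_of_le_of_ne ?_ fun heq => ?_)
  · refine MonomialOrder.degree_sub_le.trans (sup_le le_rfl ?_)
    exact MonomialOrder.degree_smul_le.trans (by rw [h])
  · have h1 := MonomialOrder.degree_mem_support (m := grevlex n) h0
    change lm (f - c • g) ∈ _ at h1
    rw [(grevlex n).toSyn.injective heq, mem_support_iff] at h1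
    apply h1
    rw [coeff_sub, coeff_smul, smul_eq_mul]
    change (grevlex n).leadingCoeff f - _ = _
    rw [h]
    change (grevlex n).leadingCoeff f - c * (grevlex n).leadingCoeff g = _
    rw [hc, div_mul_cancel₀ _ hlc, sub_self]

/-- In a coset of a subspace, either zero or an element of minimal leading monomial. -/
theorem exists_reduced (V : Submodule k (MvPolynomial (Fin n) k)) (f : MvPolynomial (Fin n) k) :
    ∃ g, g - f ∈ V ∧ (g ≠ 0 → ∀ v ∈ V, v ≠ 0 → lm v ≠ lm g) := by
  by_cases hf : f ∈ V
  · exact ⟨0, by simpa using hf, by simp⟩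
  let P : Set (MvPolynomial (Fin n) k) := {g | g - f ∈ V}
  have hP : P.Nonempty := ⟨f, by simp [P]⟩
  have hwf : WellFounded (InvImage (· < ·) fun g : MvPolynomial (Fin n) k =>
    (grevlex n).toSyn (lm g)) := InvImage.wf _ wellFounded_lt
  refine ⟨hwf.min P hP, hwf.min_mem P hP, fun h0 v hv hv0 hlm => ?_⟩
  obtain ⟨c, hc⟩ := exists_sub_smul_lt hv0 hlm.symm
  have hmem : hwf.min P hP - c • v ∈ P := by
    have := sub_mem (hwf.min_mem P hP) (V.smul_mem c hv)
    rwa [sub_right_comm] at this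
  rcases hc with hc | hc
  · rw [hc] at hmem
    exact hf (by simpa [P] using hmem)
  · exact hwf.not_lt_min P hmem hc

/-- Each row is replaced by a reduced representative of its class modulo the rows of smaller
signature. If nonzero, its leading monomial is avoided by that whole span, which contains the new
rows of smaller signature. -/
theorem exists_isEchelonForm {M : SigMatrix n t k} (hM : (M.map Prod.fst).Nodup) :
    ∃ M', IsEchelonForm M M' := by
  have hT : ∀ s : Sig n t, ∃ g, ∀ f, (s, f) ∈ M → g - f ∈ rowSpan M (sigBelow s) ∧
      (g ≠ 0 → ∀ v ∈ rowSpan M (sigBelow s), v ≠ 0 → lm v ≠ lm g) := by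
    intro s
    by_cases hs : ∃ f, (s, f) ∈ M
    · obtain ⟨f, hf⟩ := hs
      obtain ⟨g, hg⟩ := exists_reduced (rowSpan M (sigBelow s)) f
      exact ⟨g, fun f' hf' => eq_of_mem_of_nodup hM hf hf' ▸ hg⟩
    · exact ⟨0, fun f hf => absurd ⟨f, hf⟩ hs⟩
  choose T hT using hT
  refine ⟨_, isEchelonForm_map hM T (fun s f hf => (hT s f hf).1) ?_⟩
  have key : ∀ r ∈ M, ∀ r' ∈ M, sigLT r.1 r'.1 → T r.1 ≠ 0 → T r'.1 ≠ 0 →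
      lm (T r.1) ≠ lm (T r'.1) := by
    intro r hr r' hr' hlt h0 h0'
    refine (hT r'.1 r'.2 hr').2 h0' _ ?_ h0
    have h1 := rowSpan_mono (isSigLower_sigBelow _ _ hlt) (hT r.1 r.2 hr).1
    simpa using add_mem h1 (mem_rowSpan hlt hr)
  intro r hr r' hr' hne h0 h0'
  rcases sigLT_trichotomy r.1 r'.1 with h | h | h
  · exact key r hr r' hr' h h0 h0'
  · exact absurd h hne
  · exact (key r' hr' r hr h h0' h0).symm

theorem exists_isEchelonProcedure (n t : ℕ) (k : Type*) [Field k] :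
    ∃ ech : SigMatrix n t k → SigMatrix n t k, IsEchelonProcedure ech := by
  have h : ∀ M : SigMatrix n t k, ∃ M', (M.map Prod.fst).Nodup → IsEchelonForm M M' := by
    intro M
    by_cases hM : (M.map Prod.fst).Nodup
    · exact (exists_isEchelonForm hM).imp fun _ h _ => h
    · exact ⟨M, fun h => absurd h hM⟩
  choose ech hech using h
  exact ⟨ech, hech⟩

/-- Leading monomials of linear combinations of polynomials with distinct leading monomials. -/
theorem sum_eq_zero_or_lm_mem {G : Set (MvPolynomial (Fin n) k)}
    (hG : ∀ f ∈ G, ∀ g ∈ G, f ≠ g → f ≠ 0 → g ≠ 0 → lm f ≠ lm g)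
    (c : MvPolynomial (Fin n) k → k) (A : Finset (MvPolynomial (Fin n) k)) (hA : ↑A ⊆ G) :
    ∑ g ∈ A, c g • g = 0 ∨ ∃ g ∈ A, g ≠ 0 ∧ lm (∑ g ∈ A, c g • g) = lm g := by
  classical
  -- Elements enter in order of increasing leading monomial, so a nonzero new term dominates the sum
  -- so far.
  induction A using Finset.induction_on_max_value
    (f := fun g : MvPolynomial (Fin n) k => (grevlex n).toSyn (lm g)) with
  | empty => simp
  | insert a A ha hmax ih =>
    rw [Finset.coe_insert, Set.insert_subset_iff] at hA
    have ih := ih hA.2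
    rw [Finset.sum_insert ha]
    by_cases hca : c a • a = 0
    · rw [hca, zero_add]
      exact ih.imp_right fun ⟨g, hg, h⟩ => ⟨g, Finset.mem_insert_of_mem hg, h⟩
    · right
      rw [smul_eq_zero, not_or] at hca
      have hdeg : lm (c a • a) = lm a :=
        MonomialOrder.degree_smul_of_isRegular (isRegular_iff_ne_zero.2 hca.1)
      refine ⟨a, Finset.mem_insert_self _ _, hca.2, ?_⟩
      rcases ih with h0 | ⟨g, hg, hg0, hlm⟩
      · rw [h0, add_zero, hdeg]
      · rw [lm, MonomialOrder.degree_add_of_lt, ← lm, hdeg]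
        rw [← lm, ← lm, hlm, hdeg]
        refine lt_of_le_of_ne (hmax g hg) fun h => ?_
        exact hG g (hA.2 hg) a hA.1 (fun h => ha (h ▸ hg)) hg0 hca.2
          ((grevlex n).toSyn.injective h)

theorem exists_lm_eq_of_mem_rowSpan {M : SigMatrix n t k}
    (hM : M.Pairwise fun r r' => r.2 ≠ 0 → r'.2 ≠ 0 → lm r.2 ≠ lm r'.2)
    {f : MvPolynomial (Fin n) k} (hf : f ∈ rowSpan M Set.univ) (h0 : f ≠ 0) :
    ∃ g ∈ M.rows, g ≠ 0 ∧ lm f = lm g := by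
  have hset : {f | ∃ s ∈ Set.univ, (s, f) ∈ M} = M.rows := by
    ext f; simp [SigMatrix.rows]
  rw [rowSpan, hset, Submodule.mem_span_set] at hf
  obtain ⟨c, hc, rfl⟩ := hf
  have hG : ∀ f ∈ M.rows, ∀ g ∈ M.rows, f ≠ g → f ≠ 0 → g ≠ 0 → lm f ≠ lm g := by
    rintro f ⟨s, hf⟩ g ⟨s', hg⟩ hne
    have : Std.Symm fun r r' : Sig n t × MvPolynomial (Fin n) k =>
        r.2 ≠ 0 → r'.2 ≠ 0 → lm r.2 ≠ lm r'.2 := ⟨fun r r' h h1 h2 => (h h2 h1).symm⟩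
    exact hM.forall hf hg fun h => hne (congrArg Prod.snd h)
  rcases sum_eq_zero_or_lm_mem hG c c.support hc with h | ⟨g, hg, hg0, h⟩
  · exact absurd h h0
  · exact ⟨g, hc hg, hg0, h⟩

end SignedRows

/-! ### The signature algorithm -/

section SigAlgorithm

variable {n t : ℕ} {k : Type*} [Field k]

/-- The span of the products `x^τ f_i` of degree `d` whose signatures lie in `A`. -/
noncomputable def shiftSpan (F : Fin t → MvPolynomial (Fin n) k) (d : ℕ) (A : Set (Sig n t)) :
    Submodule k (MvPolynomial (Fin n) k) :=
  Submodule.span k {f | ∃ s ∈ A, s.2.degree + (F s.1).totalDegree = d ∧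
    f = monomial s.2 1 * F s.1}

/-- The signatures with index less than `i`. -/
def sigIndexLT (n t i : ℕ) : Set (Sig n t) := {s | (s.1 : ℕ) < i}

/-- `s` is the leading monomial of a syzygy: the corresponding multiple of a generator is a
combination of products of smaller signatures. -/
def IsSyzSig (F : Fin t → MvPolynomial (Fin n) k) (s : Sig n t) : Prop :=
  monomial s.2 1 * F s.1 ∈ shiftSpan F (s.2.degree + (F s.1).totalDegree) (sigBelow s)

variable {F : Fin t → MvPolynomial (Fin n) k} {d : ℕ} {A B : Set (Sig n t)}

theorem mem_shiftSpan {s : Sig n t} (hs : s ∈ A) (hd : s.2.degree + (F s.1).totalDegree = d) :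
    monomial s.2 1 * F s.1 ∈ shiftSpan F d A :=
  Submodule.subset_span ⟨s, hs, hd, rfl⟩

theorem shiftSpan_mono (h : A ⊆ B) : shiftSpan F d A ≤ shiftSpan F d B :=
  Submodule.span_mono fun _ ⟨s, hs, hf⟩ => ⟨s, h hs, hf⟩

theorem shiftSpan_le {V : Submodule k (MvPolynomial (Fin n) k)} :
    shiftSpan F d A ≤ V ↔ ∀ s ∈ A, s.2.degree + (F s.1).totalDegree = d →
      monomial s.2 1 * F s.1 ∈ V := by
  rw [shiftSpan, Submodule.span_le]
  exact ⟨fun h s hs hd => h ⟨s, hs, hd, rfl⟩, fun h f ⟨s, hs, hd, hf⟩ => hf ▸ h s hs hd⟩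

theorem sigIndexLT_subset_sigBelow (s : Sig n t) : sigIndexLT n t s.1 ⊆ sigBelow s :=
  fun _ h => Or.inl h

theorem sigBelow_subset_sigIndexLT {s : Sig n t} {i : ℕ} (h : (s.1 : ℕ) < i) :
    sigBelow s ⊆ sigIndexLT n t i := by
  rintro s' (h' | ⟨h', _⟩)
  · exact (Fin.lt_def.1 h').trans h
  · exact (congrArg Fin.val h').trans_lt h

theorem isHomogeneous_of_mem_shiftSpan (hF : ∀ i, (F i).IsHomogeneous (F i).totalDegree)
    {f : MvPolynomial (Fin n) k} (hf : f ∈ shiftSpan F d A) : f.IsHomogeneous d := by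
  have h : shiftSpan F d A ≤ homogeneousSubmodule (Fin n) k d := by
    rw [shiftSpan_le]
    rintro s - rfl
    exact (isHomogeneous_monomial 1 rfl).mul (hF s.1)
  exact h hf

theorem mem_ideal_of_mem_shiftSpan {f : MvPolynomial (Fin n) k} (hf : f ∈ shiftSpan F d A)
    {I : Ideal (MvPolynomial (Fin n) k)} (hI : ∀ s ∈ A, F s.1 ∈ I) : f ∈ I := by
  have h : shiftSpan F d A ≤ I.restrictScalars k := by
    rw [shiftSpan_le]
    intro s hs _
    exact I.mul_mem_left _ (hI s hs)
  exact h hf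

theorem mem_shiftSpan_of_mem_ideal (hF : ∀ i, (F i).IsHomogeneous (F i).totalDegree) {i : ℕ}
    {f : MvPolynomial (Fin n) k} (hf : f ∈ Ideal.span {g | ∃ l : Fin t, (l : ℕ) < i ∧ g = F l})
    (hd : f.IsHomogeneous d) : f ∈ shiftSpan F d (sigIndexLT n t i) := by
  -- Intermediate elements of the ideal need not be homogeneous; the induction therefore concerns
  -- the degree `d` component of all multiples.
  suffices H : ∀ h : MvPolynomial (Fin n) k,
      homogeneousComponent d (h * f) ∈ shiftSpan F d (sigIndexLT n t i) by
    have := H 1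
    rwa [one_mul, homogeneousComponent_of_mem hd, if_pos rfl] at this
  clear hd
  induction hf using Submodule.span_induction with
  | mem g hg =>
    obtain ⟨l, hl, rfl⟩ := hg
    intro h
    induction h using MvPolynomial.induction_on' with
    | monomial τ c =>
      have h1 : (monomial τ c * F l).IsHomogeneous (τ.degree + (F l).totalDegree) :=
        (isHomogeneous_monomial c rfl).mul (hF l)
      rw [homogeneousComponent_of_mem h1]
      split_ifs with hd
      · have : monomial τ c * F l = c • (monomial τ 1 * F l) := by
          rw [← smul_mul_assoc, smul_monomial, smul_eq_mul, mul_one]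
        rw [this]
        exact Submodule.smul_mem _ _ (mem_shiftSpan (s := (l, τ)) hl hd.symm)
      · exact zero_mem _
    | add p q hp hq =>
      rw [add_mul, map_add]
      exact add_mem hp hq
  | zero => intro h; simp
  | add x y _ _ hx hy =>
    intro h
    rw [mul_add, map_add]
    exact add_mem (hx h) (hy h)
  | smul a x _ hx =>
    intro h
    rw [smul_eq_mul, ← mul_assoc]
    exact hx _

theorem X_mul_mem_shiftSpan {f : MvPolynomial (Fin n) k} (j : Fin n) (hf : f ∈ shiftSpan F d A)
    (hB : ∀ s ∈ A, (s.1, s.2 + Finsupp.single j 1) ∈ B) : X j * f ∈ shiftSpan F (d + 1) B := by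
  have h : shiftSpan F d A ≤ (shiftSpan F (d + 1) B).comap (LinearMap.mulLeft k (X j)) := by
    rw [shiftSpan_le]
    rintro s hs rfl
    rw [Submodule.mem_comap, LinearMap.mulLeft_apply, ← mul_assoc]
    have : (X j * monomial s.2 1 : MvPolynomial (Fin n) k) =
        monomial (s.2 + Finsupp.single j 1) 1 := by
      rw [X, monomial_mul, one_mul, add_comm]
    rw [this]
    refine mem_shiftSpan (s := (s.1, s.2 + Finsupp.single j 1)) (hB s hs) ?_
    simp only [map_add, Finsupp.degree_single]
    omega
  exact h hf

/-! ### Leading monomials of syzygies -/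

theorem sigLT_add (s s' : Sig n t) (σ : Fin n →₀ ℕ) (h : sigLT s s') :
    sigLT (s.1, s.2 + σ) (s'.1, s'.2 + σ) := by
  refine h.imp id (And.imp id fun h => ?_)
  simp only [map_add]
  exact add_lt_add_left h _

theorem IsSyzSig.add_single {i : Fin t} {τ : Fin n →₀ ℕ} (h : IsSyzSig F (i, τ)) (j : Fin n) :
    IsSyzSig F (i, τ + Finsupp.single j 1) := by
  have h1 := X_mul_mem_shiftSpan j h (B := sigBelow (i, τ + Finsupp.single j 1))
    fun s hs => sigLT_add _ _ _ hs
  rw [← mul_assoc, X, monomial_mul, one_mul, add_comm (Finsupp.single j 1)] at h1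
  have h2 : (τ + Finsupp.single j 1).degree + (F i).totalDegree =
      τ.degree + (F i).totalDegree + 1 := by
    simp only [map_add, Finsupp.degree_single]; omega
  rw [IsSyzSig, h2]
  exact h1

/-- Solve for the leading term of `g`: its other terms give products of index `i` with smaller
signature, and homogeneity puts all of them in one degree. -/
theorem isSyzSig_of_mul_mem {i : Fin t} {g : MvPolynomial (Fin n) k} (h0 : g ≠ 0)
    {e : ℕ} (hg : g.IsHomogeneous e)
    (h : g * F i ∈ shiftSpan F (e + (F i).totalDegree) (sigIndexLT n t i)) :
    IsSyzSig F (i, lm g) := by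
  have hsupp := MonomialOrder.degree_mem_support (m := grevlex n) h0
  have hdeg : ∀ τ ∈ g.support, τ.degree = e := fun τ hτ => by
    have h1 := hg (mem_support_iff.1 hτ)
    rw [Finsupp.degree_eq_weight_one]
    exact h1
  have hlc : coeff (lm g) g ≠ 0 := mem_support_iff.1 hsupp
  rw [IsSyzSig, hdeg _ hsupp]
  have hsum : g * F i = coeff (lm g) g • (monomial (lm g) 1 * F i) +
      ∑ τ ∈ g.support.erase (lm g), coeff τ g • (monomial τ 1 * F i) := by
    rw [Finset.add_sum_erase _ (fun τ => coeff τ g • (monomial τ 1 * F i)) hsupp]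
    conv_lhs => rw [g.as_sum, Finset.sum_mul]
    refine Finset.sum_congr rfl fun τ _ => ?_
    rw [← smul_mul_assoc, smul_monomial, smul_eq_mul, mul_one]
  have hrest : ∑ τ ∈ g.support.erase (lm g), coeff τ g • (monomial τ 1 * F i) ∈
      shiftSpan F (e + (F i).totalDegree) (sigBelow (i, lm g)) := by
    refine sum_mem fun τ hτ => Submodule.smul_mem _ _ (mem_shiftSpan (s := (i, τ)) ?_ ?_)
    · rw [Finset.mem_erase] at hτ
      refine Or.inr ⟨rfl, lt_of_le_of_ne (MonomialOrder.le_degree hτ.2) fun h => hτ.1 ?_⟩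
      exact (grevlex n).toSyn.injective h
    · rw [hdeg τ (Finset.mem_of_mem_erase hτ)]
  have h1 := sub_mem (shiftSpan_mono (sigIndexLT_subset_sigBelow (i, lm g)) h) hrest
  rw [hsum, add_sub_cancel_right] at h1
  exact (Submodule.smul_mem_iff _ hlc).1 h1

theorem isSyzSig_of_mul_mem_ideal (hF : ∀ i, (F i).IsHomogeneous (F i).totalDegree) {i : Fin t}
    {g : MvPolynomial (Fin n) k} (h0 : g ≠ 0) {e : ℕ} (hg : g.IsHomogeneous e)
    (h : g * F i ∈ Ideal.span {f | ∃ l : Fin t, (l : ℕ) < i ∧ f = F l}) :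
    IsSyzSig F (i, lm g) :=
  isSyzSig_of_mul_mem h0 hg (mem_shiftSpan_of_mem_ideal hF h (hg.mul (hF i)))

/-! ### Invariants of the matrices of the algorithm -/

/-- The invariants of the matrices `M_{d,i}` and of their echelon forms. -/
structure SigInv (F : Fin t → MvPolynomial (Fin n) k) (d i : ℕ) (M : SigMatrix n t k) : Prop where
  nodup : (M.map Prod.fst).Nodup
  index_lt : ∀ s f, (s, f) ∈ M → (s.1 : ℕ) < i
  degree_eq : ∀ s f, (s, f) ∈ M → s.2.degree + (F s.1).totalDegree = d
  sub_mem : ∀ s f, (s, f) ∈ M → f - monomial s.2 1 * F s.1 ∈ shiftSpan F d (sigBelow s)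
  isSyzSig : ∀ s, (s.1 : ℕ) < i → s.2.degree + (F s.1).totalDegree = d → s ∉ M.map Prod.fst →
    IsSyzSig F s

variable {i : ℕ} {M M' : SigMatrix n t k}

theorem SigInv.mem_shiftSpan (h : SigInv F d i M) {s : Sig n t} {f : MvPolynomial (Fin n) k}
    (hf : (s, f) ∈ M) (hA : sigBelow s ⊆ A) (hs : s ∈ A) : f ∈ shiftSpan F d A := by
  simpa using add_mem (shiftSpan_mono hA (h.sub_mem s f hf))
    (_root_.mem_shiftSpan hs (h.degree_eq s f hf))

theorem SigInv.mem_shiftSpan_of_mem_rows (h : SigInv F d i M) {f : MvPolynomial (Fin n) k}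
    (hf : f ∈ M.rows) : f ∈ shiftSpan F d (sigIndexLT n t i) := by
  obtain ⟨s, hf⟩ := hf
  have := h.index_lt s f hf
  exact h.mem_shiftSpan hf (sigBelow_subset_sigIndexLT this) this

theorem SigInv.mem_ideal (h : SigInv F d i M) {f : MvPolynomial (Fin n) k} (hf : f ∈ M.rows) :
    f ∈ Ideal.span {g | ∃ l : Fin t, (l : ℕ) < i ∧ g = F l} :=
  mem_ideal_of_mem_shiftSpan (h.mem_shiftSpan_of_mem_rows hf)
    fun s hs => Ideal.subset_span ⟨s.1, hs, rfl⟩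

theorem SigInv.rowSpan_le (h : SigInv F d i M) (hA : IsSigLower A) :
    rowSpan M A ≤ shiftSpan F d A :=
  _root_.rowSpan_le.2 fun s hs _ hf => h.mem_shiftSpan hf (hA s hs) hs

theorem SigInv.of_sigEquiv (h : SigInv F d i M) (hM : SigEquiv M M') : SigInv F d i M' := by
  refine ⟨hM.sigs_eq ▸ h.nodup, fun s f hf => ?_, fun s f hf => ?_, fun s f hf => ?_,
    fun s hi hd hs => h.isSyzSig s hi hd (hM.sigs_eq ▸ hs)⟩
  all_goals obtain ⟨g, hg, hfg⟩ := hM.sub_mem s f hf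
  · exact h.index_lt s g hg
  · exact h.degree_eq s g hg
  · simpa using add_mem (h.rowSpan_le (isSigLower_sigBelow s) hfg) (h.sub_mem s g hg)

theorem SigInv.ech {ech : SigMatrix n t k → SigMatrix n t k} (hech : IsEchelonProcedure ech)
    (h : SigInv F d i M) : SigInv F d i (ech M) :=
  h.of_sigEquiv (sigEquiv_of_reflTransGen (hech M h.nodup).1)

/-- If the row of signature `x^τ e_i` was reduced to zero, then `x^τ e_i` is the leading monomial
of a syzygy. -/
theorem SigInv.isSyzSig_of_zero (h : SigInv F d i M) {s : Sig n t} (hs : (s, 0) ∈ M) :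
    IsSyzSig F s := by
  have h1 := h.sub_mem s 0 hs
  rw [zero_sub, neg_mem_iff, ← h.degree_eq s 0 hs] at h1
  exact h1

/-- For the F5 criterion, a row `f` of `K` lies in the ideal of the generators before `F l`, hence
so does `f * F l`. A zero row gives a syzygy directly, which is then multiplied by a variable. -/
theorem isSyzSig_of_mem_critSet (hF : ∀ i, (F i).IsHomogeneous (F i).totalDegree)
    {S : Set (Sig n t)} (hS : ∀ s ∈ S, IsSyzSig F s) {l : Fin t} {e e' : ℕ}
    {K R : SigMatrix n t k} (hK : SigInv F e l K) (hR : SigInv F e' (l + 1) R)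
    {s : Sig n t} (hs : s ∈ critSet S l K R) : IsSyzSig F s := by
  rcases hs with (hs | ⟨f, hf, h0, rfl⟩) | ⟨τ, j, hτ, rfl⟩
  · exact hS s hs
  · refine isSyzSig_of_mul_mem_ideal hF h0
      (isHomogeneous_of_mem_shiftSpan hF (hK.mem_shiftSpan_of_mem_rows hf)) ?_
    exact Ideal.mul_mem_right _ _ (hK.mem_ideal hf)
  · exact (hR.isSyzSig_of_zero hτ).add_single j

theorem mem_newRows {crit : Set (Sig n t)} {l : Fin t} {s : Sig n t} {f : MvPolynomial (Fin n) k} :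
    (s, f) ∈ newRows crit l M ↔ ∃ τ g j, ((l, τ), g) ∈ M ∧ (∀ j' ∈ τ.support, j' ≤ j) ∧
      (l, τ + Finsupp.single j 1) ∉ crit ∧ s = (l, τ + Finsupp.single j 1) ∧ f = X j * g := by
  simp only [newRows, List.mem_flatMap, List.mem_filter, List.mem_map, List.mem_finRange,
    true_and, decide_eq_true_eq, Prod.mk.injEq]
  constructor
  · rintro ⟨⟨⟨l', τ⟩, g⟩, ⟨hM, rfl⟩, j, ⟨hj, hc⟩, rfl, rfl⟩
    exact ⟨τ, g, j, hM, hj, hc, rfl, rfl⟩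
  · rintro ⟨τ, g, j, hM, hj, hc, rfl, rfl⟩
    exact ⟨((l, τ), g), ⟨hM, rfl⟩, j, ⟨hj, hc⟩, rfl, rfl⟩

/-- The split-off variable is the last one dividing the product. Hence `newRows` creates each
signature at most once. -/
theorem add_single_inj {τ τ' : Fin n →₀ ℕ} {j j' : Fin n} (hj : ∀ a ∈ τ.support, a ≤ j)
    (hj' : ∀ a ∈ τ'.support, a ≤ j') (h : τ + Finsupp.single j 1 = τ' + Finsupp.single j' 1) :
    τ = τ' ∧ j = j' := by
  have key : ∀ {τ τ' : Fin n →₀ ℕ} {j j' : Fin n}, (∀ a ∈ τ'.support, a ≤ j') →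
      τ + Finsupp.single j 1 = τ' + Finsupp.single j' 1 → j ≤ j' := by
    intro τ τ' j j' hj' h
    by_cases hjj : j = j'
    · exact hjj.le
    · have h1 := DFunLike.congr_fun h j
      rw [Finsupp.add_apply, Finsupp.add_apply, Finsupp.single_eq_same,
        Finsupp.single_eq_of_ne hjj] at h1
      exact hj' j (Finsupp.mem_support_iff.2 (by omega))
  have hjj : j = j' := le_antisymm (key hj' h) (key hj h.symm)
  subst hjj
  exact ⟨add_right_cancel h, rfl⟩

theorem nodup_newRows {crit : Set (Sig n t)} {l : Fin t} (hM : (M.map Prod.fst).Nodup) :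
    ((newRows crit l M).map Prod.fst).Nodup := by
  rw [newRows, List.map_flatMap, List.nodup_flatMap]
  constructor
  · intro r _
    rw [List.map_map]
    refine List.Nodup.map_on ?_ ((List.nodup_finRange n).filter _)
    intro j hj j' hj' h
    simp only [List.mem_filter, decide_eq_true_eq] at hj hj'
    simp only [Function.comp_apply, Prod.mk.injEq, true_and] at h
    exact (add_single_inj hj.2.1 hj'.2.1 h).2
  · have h1 : (M.filter fun r => r.1.1 = l).Pairwise fun r r' => r.1 ≠ r'.1 :=
      (List.pairwise_map.1 hM).filter _
    refine h1.imp_of_mem fun {r r'} hr hr' hne => ?_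
    simp only [List.mem_filter, decide_eq_true_eq] at hr hr'
    rw [Function.onFun, List.disjoint_left]
    intro s hs hs'
    simp only [List.map_map, List.mem_map, List.mem_filter, List.mem_finRange, true_and,
      decide_eq_true_eq, Function.comp_apply] at hs hs'
    obtain ⟨j, ⟨hj, -⟩, rfl⟩ := hs
    obtain ⟨j', ⟨hj', -⟩, h⟩ := hs'
    rw [Prod.mk.injEq] at h
    exact hne (Prod.ext (hr.2.trans hr'.2.symm) (add_single_inj hj' hj h.2).1.symm)

theorem exists_eq_add_single {σ : Fin n →₀ ℕ} (h : σ ≠ 0) :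
    ∃ τ j, (∀ j' ∈ τ.support, j' ≤ j) ∧ σ = τ + Finsupp.single j 1 := by
  have hne : σ.support.Nonempty := Finsupp.support_nonempty_iff.2 h
  have hle : Finsupp.single (σ.support.max' hne) 1 ≤ σ := by
    rw [Finsupp.single_le_iff]
    exact Nat.one_le_iff_ne_zero.2 (Finsupp.mem_support_iff.1 (σ.support.max'_mem hne))
  refine ⟨σ - Finsupp.single (σ.support.max' hne) 1, σ.support.max' hne, fun j' hj' => ?_,
    (tsub_add_cancel_of_le hle).symm⟩
  exact σ.support.le_max' _ (Finsupp.support_tsub hj')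

/-- Appending to the rows of index less than `l` the rows `x^τ f_l` for all signatures but those of
leading monomials of syzygies preserves the invariants. -/
theorem SigInv.append {l : Fin t} (h : SigInv F d l M) {N : SigMatrix n t k}
    (hnodup : (N.map Prod.fst).Nodup)
    (hN : ∀ s f, (s, f) ∈ N → s.1 = l ∧ s.2.degree + (F s.1).totalDegree = d ∧
      f = monomial s.2 1 * F s.1)
    (hsyz : ∀ τ : Fin n →₀ ℕ, τ.degree + (F l).totalDegree = d → (l, τ) ∉ N.map Prod.fst →
      IsSyzSig F (l, τ)) :
    SigInv F d (l + 1) (M ++ N) := by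
  refine ⟨?_, fun s f hf => ?_, fun s f hf => ?_, fun s f hf => ?_, fun s hi hd hs => ?_⟩
  · rw [List.map_append, List.nodup_append']
    refine ⟨h.nodup, hnodup, List.disjoint_left.2 fun s hs hs' => ?_⟩
    obtain ⟨⟨s, f⟩, hf, rfl⟩ := List.mem_map.1 hs
    obtain ⟨⟨s', f'⟩, hf', h1⟩ := List.mem_map.1 hs'
    have h2 := h.index_lt s f hf
    have h3 := (hN s' f' hf').1
    dsimp only at h1
    rw [h1] at h3
    rw [h3] at h2
    exact lt_irrefl _ h2
  · rcases List.mem_append.1 hf with hf | hf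
    · exact (h.index_lt s f hf).trans (Nat.lt_succ_self _)
    · rw [(hN s f hf).1]; exact Nat.lt_succ_self _
  · rcases List.mem_append.1 hf with hf | hf
    · exact h.degree_eq s f hf
    · exact (hN s f hf).2.1
  · rcases List.mem_append.1 hf with hf | hf
    · exact h.sub_mem s f hf
    · rw [(hN s f hf).2.2, sub_self]; exact zero_mem _
  · rw [List.map_append, List.mem_append, not_or] at hs
    rcases Nat.lt_succ_iff_lt_or_eq.1 hi with hi | hi
    · exact h.isSyzSig s hi hd hs.1
    · obtain ⟨l', τ⟩ := s
      obtain rfl : l' = l := Fin.ext hi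
      exact hsyz τ hd hs.2

/-- The second claim holds because rows of the last index are appended after the echelonization.
They are unreduced products, so their multiples by variables, appended in the next degree, are exact
products again. -/
theorem sigMatrix_inv {ech : SigMatrix n t k → SigMatrix n t k} (hech : IsEchelonProcedure ech)
    (hF : ∀ i, (F i).IsHomogeneous (F i).totalDegree) {S : Set (Sig n t)}
    (hS : ∀ s ∈ S, IsSyzSig F s) (d : ℕ) : ∀ i ≤ t, SigInv F d i (sigMatrix ech F S d i) ∧
      ∀ s f, (s, f) ∈ sigMatrix ech F S d i → (s.1 : ℕ) + 1 = i →
        f = monomial s.2 1 * F s.1 := by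
  induction d using Nat.strong_induction_on with
  | _ d ihd =>
  intro i
  induction i with
  | zero =>
    intro _
    rw [sigMatrix]
    exact ⟨⟨by simp, by simp, by simp, by simp, by simp⟩, by simp⟩
  | succ i ihi =>
    intro hi
    have hit : i < t := hi
    obtain ⟨hM, -⟩ := ihi hit.le
    have hE : SigInv F d (⟨i, hit⟩ : Fin t) (ech (sigMatrix ech F S d i)) := hM.ech hech
    have hidx : ∀ s f, (s, f) ∈ ech (sigMatrix ech F S d i) → (s.1 : ℕ) + 1 ≠ i + 1 :=
      fun s f hf h => (hE.index_lt s f hf).ne (Nat.succ_injective h)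
    rw [sigMatrix, dif_pos hit]
    split_ifs with h1 h2
    · refine ⟨⟨hM.nodup, fun s f hf => (hM.index_lt s f hf).trans (Nat.lt_succ_self _),
        hM.degree_eq, hM.sub_mem, fun s hs hd => ?_⟩, fun s f hf hs => ?_⟩
      · rcases Nat.lt_succ_iff_lt_or_eq.1 hs with hs | hs
        · exact hM.isSyzSig s hs hd
        · obtain ⟨l, τ⟩ := s
          obtain rfl : l = ⟨i, hit⟩ := Fin.ext hs
          dsimp only at hd
          -- In degrees below that of the generator no signature has its index.
          omega
      · exact absurd (Nat.succ_injective hs) (hM.index_lt s f hf).ne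
    · refine ⟨hE.append (by simp) ?_ ?_, fun s f hf hs => ?_⟩
      · intro s f hf
        obtain ⟨rfl, rfl⟩ := Prod.mk.inj (List.mem_singleton.1 hf)
        simp [h2]
      · intro τ hτ hmem
        have : τ = 0 := by rw [← Finsupp.degree_eq_zero_iff]; omega
        simp [this] at hmem
      · rcases List.mem_append.1 hf with hf | hf
        · exact absurd hs (hidx s f hf)
        · obtain ⟨rfl, rfl⟩ := Prod.mk.inj (List.mem_singleton.1 hf)
          simp
    · obtain ⟨hP, hPtop⟩ := ihd (d - 1) (by omega) (i + 1) hi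
      have hK : SigInv F (d - (F ⟨i, hit⟩).totalDegree) (⟨i, hit⟩ : Fin t)
          (sigMatrix ech F S (d - (F ⟨i, hit⟩).totalDegree) i) := by
        -- For a generator of degree 0 the F5 criterion uses the current degree, which only the
        -- inner induction covers.
        rcases Nat.eq_zero_or_pos (F ⟨i, hit⟩).totalDegree with h0 | h0
        · rw [h0]; exact hM
        · exact (ihd _ (by omega) i hit.le).1
      have hcrit := fun s => isSyzSig_of_mem_critSet hF hS hK (hP.ech hech) (s := s)
      have hnew : ∀ s f, (s, f) ∈ newRows (critSet S ⟨i, hit⟩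
          (sigMatrix ech F S (d - (F ⟨i, hit⟩).totalDegree) i)
          (ech (sigMatrix ech F S (d - 1) (i + 1)))) ⟨i, hit⟩ (sigMatrix ech F S (d - 1) (i + 1)) →
          s.1 = ⟨i, hit⟩ ∧ s.2.degree + (F s.1).totalDegree = d ∧
            f = monomial s.2 1 * F s.1 := by
        intro s f hf
        obtain ⟨τ, g, j, hg, -, -, rfl, rfl⟩ := mem_newRows.1 hf
        refine ⟨rfl, ?_, ?_⟩
        · have := hP.degree_eq _ _ hg
          simp only [map_add, Finsupp.degree_single] at this ⊢
          omega
        · rw [hPtop _ _ hg rfl, ← mul_assoc, X, monomial_mul, one_mul, add_comm]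
      refine ⟨hE.append (nodup_newRows hP.nodup) hnew ?_, fun s f hf hs => ?_⟩
      · intro σ hσ hmem
        have hσ0 : σ ≠ 0 := by
          rintro rfl
          rw [map_zero] at hσ
          omega
        obtain ⟨τ, j, hj, rfl⟩ := exists_eq_add_single hσ0
        simp only [map_add, Finsupp.degree_single] at hσ
        -- A missing signature either was excluded by the criterion, or its parent `τ` is already
        -- missing in degree `d - 1` and so is a syzygy signature.
        by_cases hτ : (⟨i, hit⟩, τ) ∈ (sigMatrix ech F S (d - 1) (i + 1)).map Prod.fst
        · obtain ⟨⟨s, g⟩, hg, rfl⟩ := List.mem_map.1 hτ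
          refine hcrit _ ?_
          by_contra hc
          exact hmem (List.mem_map.2 ⟨_, mem_newRows.2 ⟨_, g, j, hg, hj, hc, rfl, rfl⟩, rfl⟩)
        · refine (hP.isSyzSig (⟨i, hit⟩, τ) (Nat.lt_succ_self i) ?_ hτ).add_single j
          dsimp only
          omega
      · rcases List.mem_append.1 hf with hf | hf
        · exact absurd hs (hidx s f hf)
        · exact (hnew s f hf).2.2

end SigAlgorithm

/-! ### Truncated Gröbner bases from the signature algorithm -/

section TruncatedGB

variable {n t : ℕ} {k : Type*} [Field k] {F : Fin t → MvPolynomial (Fin n) k} {d : ℕ}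

theorem mem_macaulay {s : Sig n t} {f : MvPolynomial (Fin n) k} :
    (s, f) ∈ macaulay F d ↔ s.2.degree + (F s.1).totalDegree = d ∧
      f = monomial s.2 1 * F s.1 := by
  obtain ⟨i, τ⟩ := s
  have hdeg : ∀ σ : Fin n →₀ ℕ, (Finset.univ.sum σ) = σ.degree := fun σ =>
    (Finsupp.degree_eq_sum σ).symm
  simp only [macaulay, List.mem_flatMap, List.mem_finRange, true_and]
  constructor
  · rintro ⟨j, hj⟩
    split_ifs at hj with hd
    · simp at hj
    · simp only [List.mem_map, Finset.mem_toList, Finset.mem_finsuppAntidiag, hdeg,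
        Prod.mk.injEq] at hj
      obtain ⟨σ, ⟨hσ, -⟩, ⟨rfl, rfl⟩, rfl⟩ := hj
      exact ⟨by omega, rfl⟩
  · rintro ⟨hd, rfl⟩
    refine ⟨i, ?_⟩
    rw [if_neg (by omega)]
    simp only [List.mem_map, Finset.mem_toList, Finset.mem_finsuppAntidiag, hdeg]
    exact ⟨τ, ⟨by omega, Finset.subset_univ _⟩, rfl⟩

theorem nodup_macaulay : ((macaulay F d).map Prod.fst).Nodup := by
  rw [macaulay, List.map_flatMap, List.nodup_flatMap]
  constructor
  · intro i _
    split_ifs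
    · simp
    · rw [List.map_map]
      exact (Finset.nodup_toList _).map fun τ τ' h => congrArg Prod.snd h
  · refine (List.nodup_finRange t).imp fun {i j} hij => ?_
    rw [Function.onFun, List.disjoint_left]
    have key : ∀ (i : Fin t) (s : Sig n t), s ∈ List.map Prod.fst
        (if d < (F i).totalDegree then [] else
          (Finset.univ.finsuppAntidiag (d - (F i).totalDegree)).toList.map
            fun τ => ((i, τ), monomial τ (1 : k) * F i)) → s.1 = i := by
      intro i s hs
      split_ifs at hs
      · simp at hs
      · rw [List.map_map, List.mem_map] at hs
        obtain ⟨τ, -, rfl⟩ := hs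
        rfl
    exact fun s hs hs' => hij ((key i s hs).symm.trans (key j s hs'))

theorem rowSpan_macaulay (A : Set (Sig n t)) : rowSpan (macaulay F d) A = shiftSpan F d A := by
  simp only [rowSpan, shiftSpan, mem_macaulay]

/-- A matrix with the invariants of the algorithm agrees, up to zero rows, with one that
is obtained from the Macaulay matrix by valid operations. -/
theorem SigInv.exists_isEchelonForm_macaulay {M : SigMatrix n t k} (h : SigInv F d t M)
    (hM : M.Pairwise fun r r' => r.2 ≠ 0 → r'.2 ≠ 0 → lm r.2 ≠ lm r'.2) :
    ∃ E, IsEchelonForm (macaulay F d) E ∧ (∀ f ∈ M.rows, f ∈ E.rows) ∧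
      ∀ f ∈ E.rows, f ≠ 0 → f ∈ M.rows := by
  -- `T` prescribes the row of `M` where there is one and zero at the omitted signatures.
  have hT : ∀ s : Sig n t, ∃ g, (∀ f, (s, f) ∈ M → f = g) ∧
      (s ∉ M.map Prod.fst → g = 0) := by
    intro s
    by_cases hs : s ∈ M.map Prod.fst
    · obtain ⟨⟨s, f⟩, hf, rfl⟩ := List.mem_map.1 hs
      exact ⟨f, fun g hg => eq_of_mem_of_nodup h.nodup hg hf, fun h => absurd hs h⟩
    · exact ⟨0, fun f hf => absurd (List.mem_map.2 ⟨_, hf, rfl⟩) hs, fun _ => rfl⟩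
  choose T hT1 hT0 using hT
  have hTmem : ∀ s, T s ≠ 0 → (s, T s) ∈ M := by
    intro s hs
    by_cases hsM : s ∈ M.map Prod.fst
    · obtain ⟨⟨s, f⟩, hf, rfl⟩ := List.mem_map.1 hsM
      exact hT1 s f hf ▸ hf
    · exact absurd (hT0 s hsM) hs
  refine ⟨_, isEchelonForm_map nodup_macaulay T ?_ ?_, ?_, ?_⟩
  · intro s f hf
    obtain ⟨hd, rfl⟩ := mem_macaulay.1 hf
    rw [rowSpan_macaulay]
    by_cases hsM : s ∈ M.map Prod.fst
    · obtain ⟨⟨s, f⟩, hsf, rfl⟩ := List.mem_map.1 hsM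
      exact hT1 s f hsf ▸ h.sub_mem s f hsf
    · rw [hT0 s hsM, zero_sub, neg_mem_iff]
      have := h.isSyzSig s s.1.2 hd hsM
      rwa [IsSyzSig, hd] at this
  · intro r _ r' _ hne h0 h0'
    have : Std.Symm fun r r' : Sig n t × MvPolynomial (Fin n) k =>
        r.2 ≠ 0 → r'.2 ≠ 0 → lm r.2 ≠ lm r'.2 := ⟨fun r r' h h1 h2 => (h h2 h1).symm⟩
    exact hM.forall (hTmem _ h0) (hTmem _ h0') (fun h => hne (Prod.mk.inj h).1) h0 h0'
  · rintro f ⟨s, hf⟩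
    exact ⟨s, List.mem_map.2 ⟨_, mem_macaulay.2 ⟨h.degree_eq s f hf, rfl⟩,
      by rw [hT1 s f hf]⟩⟩
  · rintro f ⟨s, hf⟩ h0
    obtain ⟨r, -, hr⟩ := List.mem_map.1 hf
    obtain ⟨rfl, rfl⟩ := Prod.mk.inj hr
    exact ⟨_, hTmem _ h0⟩

/-! ### Ideals of leading monomials and the collected bases -/

theorem lmIdeal_eq_span_image (G : Set (MvPolynomial (Fin n) k)) :
    lmIdeal G = Ideal.span ((fun τ => monomial τ (1 : k)) '' {τ | ∃ g ∈ G, g ≠ 0 ∧ τ = lm g}) := by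
  rw [lmIdeal]
  congr 1
  ext u
  constructor
  · rintro ⟨g, hg, h0, rfl⟩
    exact ⟨_, ⟨g, hg, h0, rfl⟩, rfl⟩
  · rintro ⟨_, ⟨g, hg, h0, rfl⟩, rfl⟩
    exact ⟨g, hg, h0, rfl⟩

theorem exists_lm_le_of_mem_lmIdeal {G : Set (MvPolynomial (Fin n) k)} {f : MvPolynomial (Fin n) k}
    (hf : f ∈ lmIdeal G) {τ : Fin n →₀ ℕ} (hτ : τ ∈ f.support) :
    ∃ g ∈ G, g ≠ 0 ∧ lm g ≤ τ := by
  rw [lmIdeal_eq_span_image, mem_ideal_span_monomial_image] at hf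
  obtain ⟨_, ⟨g, hg, h0, rfl⟩, hle⟩ := hf τ hτ
  exact ⟨g, hg, h0, hle⟩

theorem monomial_mem_lmIdeal {G : Set (MvPolynomial (Fin n) k)} {g : MvPolynomial (Fin n) k}
    (hg : g ∈ G) (h0 : g ≠ 0) : monomial (lm g) 1 ∈ lmIdeal G :=
  Ideal.subset_span ⟨g, hg, h0, rfl⟩

theorem lmIdeal_mono {G G' : Set (MvPolynomial (Fin n) k)} (h : G ⊆ G') :
    lmIdeal G ≤ lmIdeal G' :=
  Ideal.span_mono fun _ ⟨g, hg, h0, hu⟩ => ⟨g, h hg, h0, hu⟩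

/-- The algorithm tests the polynomial `f`, not its leading monomial. A monomial ideal contains all
terms of its members, so the rows that are discarded are redundant. -/
theorem monomial_lm_mem_lmIdeal {G : Set (MvPolynomial (Fin n) k)} {f : MvPolynomial (Fin n) k}
    (hf : f ∈ lmIdeal G) (h0 : f ≠ 0) : monomial (lm f) 1 ∈ lmIdeal G := by
  rw [lmIdeal_eq_span_image, mem_ideal_span_monomial_image]
  intro τ hτ
  obtain rfl : τ = lm f := by
    have := support_monomial_subset hτ
    simpa using this
  obtain ⟨g, hg, hg0, hle⟩ :=
    exists_lm_le_of_mem_lmIdeal hf (MonomialOrder.degree_mem_support (m := grevlex n) h0)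
  exact ⟨_, ⟨g, hg, hg0, rfl⟩, hle⟩

variable {ech : SigMatrix n t k → SigMatrix n t k} {S : Set (Sig n t)} {i : ℕ}

theorem mem_sigBasis {N : ℕ} {g : MvPolynomial (Fin n) k} (hg : g ∈ sigBasis ech F S i N) :
    g ≠ 0 ∧ ∃ d < N, g ∈ (ech (sigMatrix ech F S d i)).rows := by
  induction N with
  | zero => simp [sigBasis] at hg
  | succ N ih =>
    rw [sigBasis, List.mem_append] at hg
    rcases hg with hg | hg
    · obtain ⟨h0, d, hd, h⟩ := ih hg
      exact ⟨h0, d, hd.trans (Nat.lt_succ_self N), h⟩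
    · simp only [List.mem_filter, List.mem_map, decide_eq_true_eq] at hg
      obtain ⟨⟨⟨s, f⟩, hf, rfl⟩, hg⟩ := hg
      refine ⟨?_, N, Nat.lt_succ_self N, s, hf⟩
      rintro rfl
      exact hg (zero_mem _)

theorem monomial_mem_lmIdeal_sigBasis {N d : ℕ} (hd : d < N) {f : MvPolynomial (Fin n) k}
    (hf : f ∈ (ech (sigMatrix ech F S d i)).rows) (h0 : f ≠ 0) :
    monomial (lm f) 1 ∈ lmIdeal {g | g ∈ sigBasis ech F S i N} := by
  induction N with
  | zero => omega
  | succ N ih =>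
    have hsub : {g | g ∈ sigBasis ech F S i N} ⊆ {g | g ∈ sigBasis ech F S i (N + 1)} := by
      intro g hg
      rw [Set.mem_ofPred_eq, sigBasis]
      exact List.mem_append_left _ hg
    rcases Nat.lt_succ_iff_lt_or_eq.1 hd with hd | rfl
    · exact lmIdeal_mono hsub (ih hd)
    · by_cases hmem : f ∈ lmIdeal {g | g ∈ sigBasis ech F S i d}
      · exact lmIdeal_mono hsub (monomial_lm_mem_lmIdeal hmem h0)
      · refine monomial_mem_lmIdeal ?_ h0
        obtain ⟨s, hf⟩ := hf
        rw [Set.mem_ofPred_eq, sigBasis]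
        refine List.mem_append_right _ (List.mem_filter.2 ⟨List.mem_map.2 ⟨_, hf, rfl⟩, ?_⟩)
        simpa using hmem

/-- Correctness of the signature algorithm. -/
theorem isTruncatedGB_sigGB (hech : IsEchelonProcedure ech)
    (hF : ∀ i, (F i).IsHomogeneous (F i).totalDegree) (hS : ∀ s ∈ S, IsSyzSig F s) (D : ℤ) :
    IsTruncatedGB F D {g | g ∈ sigGB ech F S D t} := by
  have hinv := fun d => (sigMatrix_inv hech hF hS d t le_rfl).1
  choose E hE hsub hrows using fun d => ((hinv d).ech hech).exists_isEchelonForm_macaulay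
    (hech _ (hinv d).nodup).2
  have hsubset : {g | g ∈ sigGB ech F S D t} ⊆ {f | ∃ d : ℕ, (d : ℤ) ≤ D ∧ f ∈ (E d).rows} := by
    intro g hg
    obtain ⟨-, d, hd, hg⟩ := mem_sigBasis hg
    -- `d < (D + 1).toNat` means `d ≤ D`; for negative `D` there is no such degree.
    exact ⟨d, by omega, hsub d g hg⟩
  refine ⟨E, hE, hsubset, le_antisymm (lmIdeal_mono hsubset) ?_⟩
  refine Ideal.span_le.2 ?_
  rintro _ ⟨f, ⟨d, hd, hf⟩, h0, rfl⟩
  exact monomial_mem_lmIdeal_sigBasis (by omega) (hrows d f hf h0) h0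

/-- The elements of a truncated Gröbner basis lie in the ideal. -/
theorem IsTruncatedGB.mem_ideal {D : ℤ} {G : Set (MvPolynomial (Fin n) k)}
    (hG : IsTruncatedGB F D G) {g : MvPolynomial (Fin n) k} (hg : g ∈ G) :
    g ∈ Ideal.span {f | ∃ l, f = F l} := by
  obtain ⟨E, hE, hsub, -⟩ := hG
  obtain ⟨d, -, s, hs⟩ := hsub hg
  have h1 : g ∈ rowSpan (E d) Set.univ := mem_rowSpan (Set.mem_univ s) hs
  rw [(sigEquiv_of_reflTransGen (hE d).1).rowSpan_eq _ (fun _ _ => Set.subset_univ _),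
    rowSpan_macaulay] at h1
  exact mem_ideal_of_mem_shiftSpan h1 fun s _ => Ideal.subset_span ⟨s.1, rfl⟩

/-- The leading monomials of a truncated Gröbner basis divide those of the ideal. -/
theorem IsTruncatedGB.exists_lm_le (hF : ∀ i, (F i).IsHomogeneous (F i).totalDegree)
    {D : ℤ} {G : Set (MvPolynomial (Fin n) k)} (hG : IsTruncatedGB F D G) (hd : (d : ℤ) ≤ D)
    {f : MvPolynomial (Fin n) k} (hf : f ∈ Ideal.span {f | ∃ l, f = F l})
    (hfd : f.IsHomogeneous d) (h0 : f ≠ 0) : ∃ g ∈ G, g ≠ 0 ∧ lm g ≤ lm f := by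
  obtain ⟨E, hE, -, hlm⟩ := hG
  have hset : {g | ∃ l, g = F l} = {g | ∃ l : Fin t, (l : ℕ) < t ∧ g = F l} := by
    ext g; simp
  rw [hset] at hf
  have h1 := shiftSpan_mono (Set.subset_univ _) (mem_shiftSpan_of_mem_ideal hF hf hfd)
  rw [← rowSpan_macaulay, ← (sigEquiv_of_reflTransGen (hE d).1).rowSpan_eq _
    (fun _ _ => Set.subset_univ _)] at h1
  -- Valid operations preserve the full row span, so `f` is a combination of rows with distinct
  -- leading monomials.
  obtain ⟨g, hg, hg0, hfg⟩ := exists_lm_eq_of_mem_rowSpan (hE d).2 h1 h0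
  have h2 := monomial_mem_lmIdeal (G := {f | ∃ d : ℕ, (d : ℤ) ≤ D ∧ f ∈ (E d).rows})
    ⟨d, hd, hg⟩ hg0
  rw [← hlm, ← hfg] at h2
  exact exists_lm_le_of_mem_lmIdeal h2 (by simp)

/-- The elements of the `i`-th basis are nonzero, homogeneous, and lie in the ideal of the first
`i` generators. -/
theorem sigGB_spec (hech : IsEchelonProcedure ech)
    (hF : ∀ i, (F i).IsHomogeneous (F i).totalDegree) (hS : ∀ s ∈ S, IsSyzSig F s) {D : ℤ}
    (hi : i ≤ t) {g : MvPolynomial (Fin n) k} (hg : g ∈ sigGB ech F S D i) :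
    g ≠ 0 ∧ (∃ d, g.IsHomogeneous d) ∧
      g ∈ Ideal.span {f | ∃ l : Fin t, (l : ℕ) < i ∧ f = F l} := by
  obtain ⟨h0, d, -, hg⟩ := mem_sigBasis hg
  have hinv := (sigMatrix_inv hech hF hS d i hi).1.ech hech
  exact ⟨h0, ⟨d, isHomogeneous_of_mem_shiftSpan hF (hinv.mem_shiftSpan_of_mem_rows hg)⟩,
    hinv.mem_ideal hg⟩

end TruncatedGB

/-! ### Syzygies of maximal minors -/

section MinorSyzygies

/-- Expansion of a determinant with a repeated row: an entry of a column to the left of all those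
of a maximal minor multiplies this minor into the ideal of the lexicographically smaller ones. -/
theorem mul_det_mem_span_lt {R : Type*} [CommRing R] {p q : ℕ} (A : Matrix (Fin p) (Fin q) R)
    (r : Fin p) (c : Fin q) {J : Fin p → Fin q} (hJ : StrictMono J) (hc : ∀ l, c < J l) :
    A r c * (A.submatrix id J).det ∈ Ideal.span {f | ∃ J' : Fin p → Fin q, StrictMono J' ∧
      toLex J' < toLex J ∧ f = (A.submatrix id J').det} := by
  set cols : Fin (p + 1) → Fin q := Fin.cons c J with hcols
  have hmono : StrictMono cols := by
    intro a b hab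
    induction b using Fin.cases with
    | zero => exact absurd hab (Fin.not_lt_zero a)
    | succ b =>
      induction a using Fin.cases with
      | zero => simpa [hcols] using hc b
      | succ a => simpa [hcols] using hJ (Fin.succ_lt_succ_iff.1 hab)
  have hdet : (A.submatrix (Fin.cons r id : Fin (p + 1) → Fin p) cols).det = 0 :=
    Matrix.det_zero_of_row_eq (Fin.succ_ne_zero r).symm (by ext l; simp)
  rw [Matrix.det_succ_row_zero, Fin.sum_univ_succ] at hdet
  have h0 : ∀ l : Fin (p + 1), ((A.submatrix (Fin.cons r id : Fin (p + 1) → Fin p) cols).submatrix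
      Fin.succ l.succAbove) = A.submatrix id (cols ∘ l.succAbove) := by
    intro l; ext; simp
  simp only [h0] at hdet
  have hJ0 : cols ∘ (0 : Fin (p + 1)).succAbove = J := by
    ext l; simp [hcols]
  rw [hJ0] at hdet
  simp only [Fin.val_zero, pow_zero, one_mul, Matrix.submatrix_apply, Fin.cons_zero, hcols] at hdet
  rw [← hcols] at hdet
  -- The first term of the expansion omits column `c` and is the product in question; all others
  -- omit a column of `J` and keep `c`.
  rw [eq_neg_of_add_eq_zero_left hdet, neg_mem_iff]
  refine sum_mem fun l _ => Ideal.mul_mem_left _ _ (Ideal.subset_span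
    ⟨_, hmono.comp (Fin.strictMono_succAbove _), ?_, rfl⟩)
  have hp : 0 < p := l.pos
  -- The comparison is decided at the first position, where the new sequence has `c < J 0`.
  refine ⟨⟨0, hp⟩, fun j hj => absurd hj (by simp [Fin.lt_def]), ?_⟩
  have h1 : l.succ.succAbove ⟨0, hp⟩ = 0 := by
    rw [Fin.succAbove_of_castSucc_lt _ _ (by simp [Fin.lt_def])]
    rfl
  change cols (l.succ.succAbove ⟨0, hp⟩) < J ⟨0, hp⟩
  rw [h1]
  simpa [hcols] using hc ⟨0, hp⟩

theorem strictMono_minorCols {p q : ℕ} (j : Fin (incSeqs p q).card) :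
    StrictMono (minorCols p q j) := by
  have h := Finset.orderEmbOfFin_mem (incSeqs p q) rfl j
  exact (Finset.mem_filter.1 h).2

theorem exists_minorCols_eq {p q : ℕ} {J : Fin p → Fin q} (hJ : StrictMono J) :
    ∃ j, minorCols p q j = J := by
  have h : toLex J ∈ Set.range ((incSeqs p q).orderEmbOfFin rfl) := by
    rw [Finset.range_orderEmbOfFin, Finset.mem_coe]
    exact Finset.mem_filter.2 ⟨Finset.mem_univ _, hJ⟩
  obtain ⟨j, hj⟩ := h
  exact ⟨j, congrArg ofLex hj⟩

theorem minorCols_lt_iff {p q : ℕ} {i j : Fin (incSeqs p q).card} :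
    toLex (minorCols p q i) < toLex (minorCols p q j) ↔ i < j :=
  ((incSeqs p q).orderEmbOfFin rfl).lt_iff_lt

variable {n p q : ℕ} {k : Type*} [Field k]

/-- The polynomials that multiply the `j`-th minor into the ideal of the earlier ones form an ideal.
It contains the entries in columns left of the minor, hence every `g` in the ideal they generate. -/
theorem isSyzSig_of_mem_minorSyzygies {A : Matrix (Fin p) (Fin q) (MvPolynomial (Fin n) k)}
    (hA : ∀ i j, (A i j).IsHomogeneous (A i j).totalDegree)
    (hminors : ∀ j, (maxMinors A j).IsHomogeneous (maxMinors A j).totalDegree)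
    {ech : SigMatrix n ((q - p) * p) k → SigMatrix n ((q - p) * p) k}
    (hech : IsEchelonProcedure ech) {D : ℤ} {s : Sig n (incSeqs p q).card}
    (hs : s ∈ minorSyzygies p q (sigGB ech (colEntries A) ∅ D)) : IsSyzSig (maxMinors A) s := by
  obtain ⟨j, τ⟩ := s
  obtain ⟨i, hi, g, hg, hτ⟩ := hs
  dsimp only at hi hτ
  obtain ⟨h0, ⟨e, he⟩, hmem⟩ :=
    sigGB_spec hech (fun i => hA _ _) (by simp) (Nat.succ_le_of_lt i.2) hg
  rw [hτ]
  refine isSyzSig_of_mul_mem_ideal hminors h0 he ?_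
  clear hg h0 he hτ
  induction hmem using Submodule.span_induction with
  | mem f hf =>
    obtain ⟨l, hl, rfl⟩ := hf
    have hc : ∀ r, Fin.castLE (Nat.sub_le q p) l.divNat < minorCols p q j r := by
      intro r
      rw [Fin.lt_def]
      refine lt_of_le_of_lt ?_ (hi r)
      -- Entries are listed column by column, so those up to the `i`-th lie in columns at most `i /
      -- p`.
      exact Nat.div_le_div_right (Nat.le_of_lt_succ hl)
    have h1 := mul_det_mem_span_lt A l.modNat _ (strictMono_minorCols j) hc
    refine Ideal.span_mono ?_ h1
    rintro _ ⟨J, hJ, hlt, rfl⟩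
    obtain ⟨m, rfl⟩ := exists_minorCols_eq hJ
    exact ⟨m, minorCols_lt_iff.1 hlt, rfl⟩
  | zero => rw [zero_mul]; exact zero_mem _
  | add x y _ _ hx hy => rw [add_mul]; exact add_mem hx hy
  | smul a x _ hx => rw [smul_eq_mul, mul_assoc]; exact Ideal.mul_mem_left _ _ hx

theorem maxMinorsIdeal_eq_span (A : Matrix (Fin p) (Fin q) (MvPolynomial (Fin n) k)) :
    maxMinorsIdeal A = Ideal.span {f | ∃ j, f = maxMinors A j} := by
  rw [maxMinorsIdeal]
  congr 1
  ext f
  constructor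
  · rintro ⟨J, hJ, rfl⟩
    obtain ⟨j, rfl⟩ := exists_minorCols_eq hJ
    exact ⟨j, rfl⟩
  · rintro ⟨j, rfl⟩
    exact ⟨_, strictMono_minorCols j, rfl⟩

end MinorSyzygies

/-! ### Correctness of the algorithm for maximal minors -/

theorem mainTheorem2 {n p q : ℕ} {k : Type*} [Field k] (hpq : p ≤ q)
    (A : Matrix (Fin p) (Fin q) (MvPolynomial (Fin n) k))
    (hA : ∀ i j, (A i j).IsHomogeneous (A i j).totalDegree)
    (hminors : ∀ j, (maxMinors A j).IsHomogeneous (maxMinors A j).totalDegree)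
    (D : ℤ) :
    (∃ ech : SigMatrix n ((q - p) * p) k → SigMatrix n ((q - p) * p) k,
      IsEchelonProcedure ech) ∧
    (∃ ech : SigMatrix n (incSeqs p q).card k → SigMatrix n (incSeqs p q).card k,
      IsEchelonProcedure ech) ∧
    ∀ (ech₁ : SigMatrix n ((q - p) * p) k → SigMatrix n ((q - p) * p) k)
      (ech₂ : SigMatrix n (incSeqs p q).card k → SigMatrix n (incSeqs p q).card k),
      IsEchelonProcedure ech₁ → IsEchelonProcedure ech₂ →
      IsTruncatedGB (maxMinors A) D {g | g ∈ maxMinorsSigGB ech₁ ech₂ A D} ∧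
      (∀ g ∈ maxMinorsSigGB ech₁ ech₂ A D, g ∈ maxMinorsIdeal A) ∧
      ∀ (d : ℕ) (f : MvPolynomial (Fin n) k), (d : ℤ) ≤ D → f ∈ maxMinorsIdeal A →
        f.IsHomogeneous d → f ≠ 0 →
        ∃ g ∈ maxMinorsSigGB ech₁ ech₂ A D, g ≠ 0 ∧ lm g ≤ lm f := by
  refine ⟨exists_isEchelonProcedure _ _ _, exists_isEchelonProcedure _ _ _, ?_⟩
  intro ech₁ ech₂ h₁ h₂
  have hGB : IsTruncatedGB (maxMinors A) D {g | g ∈ maxMinorsSigGB ech₁ ech₂ A D} :=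
    isTruncatedGB_sigGB h₂ hminors (fun _ => isSyzSig_of_mem_minorSyzygies hA hminors h₁) D
  rw [maxMinorsIdeal_eq_span]
  exact ⟨hGB, fun g hg => hGB.mem_ideal hg,
    fun d f hd hf hfd h0 => hGB.exists_lm_le hminors hd hf hfd h0⟩
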